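/- Let $\mathbf k$ be a field of characteristic zero and let $\mathbf C$ be a set of colors. A differential colored operad is a (symmetric, unital) $\mathbf C$-colored operad in $\mathbb Z$-graded chain complexes over $\mathbf k$ (differentials of degree $-1$) whose components $\mathcal P\binom{c}{c_1,\dots,c_n}$, $c,c_1,\dots,c_n\in\mathbf C$, are indexed by $n\ge 1$; maps of such operads are the identity on $\mathbf C$. Let $\Gamma(E)$ denote the free graded $\mathbf C$-colored operad on a graded $\mathbf C$-colored collection $E$ (with components of arity $n \geq 1$ and right actions of the symmetric groups), let $*$ denote the coproduct of $\mathbf C$-colored operads, and let $\mathbf 1$ denote the trivial (initial) $\mathbf C$-colored operad, with $\mathbf 1\binom{c}{c}=\mathbf k$ and all other components zero. An elemental cofibration is a map of differential colored operads of the form $$\iota:(\mathcal S,\partial)\hookrightarrow(\mathcal S*\Gamma(E),\partial),$$ where $E=\bigoplus_{n\ge 0}E_n$ as a collection and $\partial(E_n)\subset\mathcal S*\Gamma(E)_{<n}$ for each $n\ge 0$, with $\Gamma(E)_{<n}$ the suboperad of $\Gamma(E)$ generated by $\bigoplus_{j<n}E_j$. A differential colored operad $\mathcal R$ is elementally cofibrant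 if the canonical map $\eta:\mathbf 1\to\mathcal R$ given by the units is an elemental cofibration. **Theorem.** For every map $f:\mathcal S\to\mathcal Q$ of differential colored operads there exist a differential colored operad $\mathcal R$, an elemental cofibration $\iota:\mathcal S\hookrightarrow\mathcal R$ and a map of differential colored operads $\alpha:\mathcal R\to\mathcal Q$ that induces an isomorphism on homology, such that $\alpha\circ\iota=f$. In particular, every differential colored operad $\mathcal P$ has a cofibrant model: there exist an elementally cofibrant $\mathcal R$ and a map $\alpha:\mathcal R\to\mathcal P$ of differential colored operads that induces an isomorphism on homology. -/

import Mathlib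

universe u v w

/-!
Colored operads in chain complexes over a commutative ring `k`, with set of colors `C`.

* Chain complexes are graded by the integers and differentials have degree `-1`.
* Operations have at least one input.  An operation with `n + 1` inputs has its inputs numbered by
  `Fin (n + 1)`, so a profile is a word of input colors `c : Fin (n + 1) → C` with an output
  color `d : C`.
* Underlying modules live in `Type (max u v w)`, where `k : Type u` and `C : Type v`, so that free
  operads and coproducts of operads exist within the universe over which they are characterized.
-/

/-- A `C`-colored collection of graded `k`-modules: modules `E(c₁, …, c_{n+1}; d)_p`, with right
actions of the symmetric groups that permute the input colors.  The equation between `c'` and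
`c ∘ σ` is kept as a hypothesis, to avoid transports along equalities of words. -/
structure ColoredCollection (k : Type u) [CommRing k] (C : Type v) where
  /-- `obj n c d p` is the degree `p` part of the component with inputs `c` and output `d`. -/
  obj : ∀ n : ℕ, (Fin (n + 1) → C) → C → ℤ → Type (max u v w)
  [addCommGroup : ∀ n c d p, AddCommGroup (obj n c d p)]
  [module : ∀ n c d p, Module k (obj n c d p)]
  /-- The right action: the input number `j` of `x σ` is the input number `σ j` of `x`. -/
  act : ∀ {n : ℕ} (σ : Equiv.Perm (Fin (n + 1))) {c c' : Fin (n + 1) → C} {d : C} {p : ℤ},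
    (∀ j, c' j = c (σ j)) → (obj n c d p →ₗ[k] obj n c' d p)
  act_one : ∀ {n : ℕ} {c : Fin (n + 1) → C} {d : C} {p : ℤ}
    (h : ∀ j, c j = c ((1 : Equiv.Perm (Fin (n + 1))) j)) (x : obj n c d p), act 1 h x = x
  act_mul : ∀ {n : ℕ} (σ τ : Equiv.Perm (Fin (n + 1))) {c c' c'' : Fin (n + 1) → C} {d : C} {p : ℤ}
    (h : ∀ j, c' j = c (σ j)) (h' : ∀ j, c'' j = c' (τ j)) (h'' : ∀ j, c'' j = c ((σ * τ) j))
    (x : obj n c d p), act τ h' (act σ h x) = act (σ * τ) h'' x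

attribute [instance] ColoredCollection.addCommGroup ColoredCollection.module

namespace ColoredCollection

variable {k : Type u} [CommRing k] {C : Type v}

/-- A map of collections: linear, of degree zero, equivariant. -/
structure Hom (E F : ColoredCollection.{u, v, w} k C) where
  map : ∀ {n : ℕ} {c : Fin (n + 1) → C} {d : C} {p : ℤ}, E.obj n c d p →ₗ[k] F.obj n c d p
  map_act : ∀ {n : ℕ} (σ : Equiv.Perm (Fin (n + 1))) {c c' : Fin (n + 1) → C} {d : C} {p : ℤ}
    (h : ∀ j, c' j = c (σ j)) (x : E.obj n c d p), map (E.act σ h x) = F.act σ h (map x)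

open scoped DirectSum in
/-- The direct sum of a sequence of collections. -/
noncomputable def directSum (E : ℕ → ColoredCollection.{u, v, w} k C) :
    ColoredCollection.{u, v, w} k C where
  obj n c d p := ⨁ s : ℕ, (E s).obj n c d p
  act σ _ _ _ _ h := DirectSum.lmap fun s => (E s).act σ h
  act_one h x := by
    ext s
    simp [act_one]
  act_mul σ τ _ _ _ _ _ h h' h'' x := by
    ext s
    simp only [DirectSum.lmap_apply]
    exact (E s).act_mul σ τ h h' h'' (x s)

/-- The inclusion of the `s`-th summand into a direct sum of collections. -/
noncomputable def directSumIncl (E : ℕ → ColoredCollection.{u, v, w} k C) (s : ℕ) :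
    Hom (E s) (directSum E) where
  map {n c d p} := DirectSum.lof k ℕ (fun t => (E t).obj n c d p) s
  map_act σ _ _ _ _ h x :=
    (DirectSum.lmap_lof (f := fun t => (E t).act σ h) s x).symm

end ColoredCollection

/-- The combinatorial datum of a partial composition `x ∘ᵢ y`, where `x` has input colors `c` and
`y` has input colors `b` and output color `d`: the input `i = slot` of `x` into which `y` is
plugged, which must have color `d`, and a numbering, respecting colors, of the inputs of the
composite, which are the inputs of `x` other than `i` together with the inputs of `y`.
(Then necessarily `N = m + n`. The usual partial composition is the one with the standard numbering;
the other numberings differ from it by a permutation.) -/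
structure Grafting {C : Type v} {m n N : ℕ} (c : Fin (m + 1) → C) (b : Fin (n + 1) → C) (d : C)
    (a : Fin (N + 1) → C) where
  slot : Fin (m + 1)
  numbering : {j : Fin (m + 1) // j ≠ slot} ⊕ Fin (n + 1) ≃ Fin (N + 1)
  color_slot : c slot = d
  color_outer : ∀ j, a (numbering (Sum.inl j)) = c j.1
  color_inner : ∀ j, a (numbering (Sum.inr j)) = b j

namespace Grafting

variable {C : Type v} {m n N : ℕ} {c : Fin (m + 1) → C} {b : Fin (n + 1) → C} {d : C}
  {a : Fin (N + 1) → C}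

/-- The number, in the composite, of the input `j ≠ slot` of the outer operation. -/
def outer (g : Grafting c b d a) (j : Fin (m + 1)) (hj : j ≠ g.slot) : Fin (N + 1) :=
  g.numbering (Sum.inl ⟨j, hj⟩)

/-- The number, in the composite, of the input `j` of the inner operation. -/
def inner (g : Grafting c b d a) (j : Fin (n + 1)) : Fin (N + 1) :=
  g.numbering (Sum.inr j)

/-- The iterated composites `(x ∘ y) ∘ z`, formed by `g` and then `g'`, and `x ∘ (y ∘ z)`, where
`y ∘ z` is formed by `h'` and then plugged into `x` by `h`, have the same shape: `y` is plugged into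
the same input of `x`, and `z` into the same input of `y`, and the inputs of the two results are
numbered in the same way. -/
def Sequential {l M L : ℕ} {f : Fin (l + 1) → C} {d' : C} {t : Fin (M + 1) → C}
    {s : Fin (L + 1) → C} (g : Grafting c b d a) (g' : Grafting a f d' t)
    (h : Grafting c s d t) (h' : Grafting b f d' s) : Prop :=
  h.slot = g.slot ∧ g'.slot = g.inner h'.slot ∧
  (∀ (j : Fin (m + 1)) (h₁ : j ≠ g.slot) (h₂ : g.outer j h₁ ≠ g'.slot) (h₃ : j ≠ h.slot),
    g'.outer (g.outer j h₁) h₂ = h.outer j h₃) ∧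
  (∀ (j : Fin (n + 1)) (h₁ : g.inner j ≠ g'.slot) (h₂ : j ≠ h'.slot),
    g'.outer (g.inner j) h₁ = h.inner (h'.outer j h₂)) ∧
  (∀ j : Fin (l + 1), g'.inner j = h.inner (h'.inner j))

/-- The iterated composites `(x ∘ y) ∘ z`, formed by `g` and then `g'`, and `(x ∘ z) ∘ y`, formed by
`h` and then `h'`, where `y` and `z` are plugged into two different inputs of `x`, have the same
shape: `y` is plugged into the same input of `x` in both, and so is `z`, and the inputs of the
two results are numbered in the same way. -/
def Parallel {l M L : ℕ} {f : Fin (l + 1) → C} {d' : C} {t : Fin (M + 1) → C}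
    {s : Fin (L + 1) → C} (g : Grafting c b d a) (g' : Grafting a f d' t)
    (h : Grafting c f d' s) (h' : Grafting s b d t) : Prop :=
  (∃ hne : h.slot ≠ g.slot, g'.slot = g.outer h.slot hne ∧ h'.slot = h.outer g.slot hne.symm) ∧
  (∀ (j : Fin (m + 1)) (h₁ : j ≠ g.slot) (h₂ : g.outer j h₁ ≠ g'.slot) (h₃ : j ≠ h.slot)
    (h₄ : h.outer j h₃ ≠ h'.slot), g'.outer (g.outer j h₁) h₂ = h'.outer (h.outer j h₃) h₄) ∧
  (∀ (j : Fin (n + 1)) (h₁ : g.inner j ≠ g'.slot), g'.outer (g.inner j) h₁ = h'.inner j) ∧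
  (∀ (j : Fin (l + 1)) (h₁ : h.inner j ≠ h'.slot), g'.inner j = h'.outer (h.inner j) h₁)

theorem arity_eq (g : Grafting c b d a) : N = m + n := by
  have h := Fintype.card_congr g.numbering
  simp [Fintype.card_subtype_compl] at h
  omega

end Grafting

/-- A `C`-colored (symmetric, unital) operad of graded `k`-modules, given by its partial
compositions. -/
structure GradedOperad (k : Type u) [CommRing k] (C : Type v) extends
    ColoredCollection.{u, v, w} k C where
  /-- The units of the operad. -/
  one : ∀ d : C, obj 0 (fun _ => d) d 0
  /-- Partial compositions, bilinear and additive in degrees. -/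
  comp : ∀ {m n N : ℕ} {c : Fin (m + 1) → C} {b : Fin (n + 1) → C} {d' : C} {a : Fin (N + 1) → C}
    (_ : Grafting c b d' a) {d : C} {p q r : ℤ}, p + q = r →
    (obj m c d p →ₗ[k] obj n b d' q →ₗ[k] obj N a d r)
  /-- Permuting the inputs of a composite changes the numbering of its inputs. -/
  act_comp : ∀ {m n N : ℕ} {c : Fin (m + 1) → C} {b : Fin (n + 1) → C} {d' : C}
    {a a' : Fin (N + 1) → C} (g : Grafting c b d' a) (g' : Grafting c b d' a')
    (σ : Equiv.Perm (Fin (N + 1))) (hσ : ∀ j, a' j = a (σ j)),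
    g'.slot = g.slot →
    (∀ j (h : j ≠ g.slot) (h' : j ≠ g'.slot), σ (g'.outer j h') = g.outer j h) →
    (∀ j, σ (g'.inner j) = g.inner j) →
    ∀ {d : C} {p q r : ℤ} (hr : p + q = r) (x : obj m c d p) (y : obj n b d' q),
      act σ hσ (comp g hr x y) = comp g' hr x y
  /-- Equivariance in the two factors of a composite. -/
  comp_act : ∀ {m n N : ℕ} {c c' : Fin (m + 1) → C} {b b' : Fin (n + 1) → C} {d' : C}
    {a : Fin (N + 1) → C} (g : Grafting c b d' a) (g' : Grafting c' b' d' a)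
    (σ : Equiv.Perm (Fin (m + 1))) (hσ : ∀ j, c' j = c (σ j))
    (τ : Equiv.Perm (Fin (n + 1))) (hτ : ∀ j, b' j = b (τ j)),
    g.slot = σ g'.slot →
    (∀ j (h : σ j ≠ g.slot) (h' : j ≠ g'.slot), g.outer (σ j) h = g'.outer j h') →
    (∀ j, g.inner (τ j) = g'.inner j) →
    ∀ {d : C} {p q r : ℤ} (hr : p + q = r) (x : obj m c d p) (y : obj n b d' q),
      comp g' hr (act σ hσ x) (act τ hτ y) = comp g hr x y
  /-- `(x ∘ y) ∘ z = x ∘ (y ∘ z)`, when `z` is plugged into an input of `y`. -/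
  comp_sequential : ∀ {m n l N M L : ℕ} {c : Fin (m + 1) → C} {b : Fin (n + 1) → C}
    {f : Fin (l + 1) → C} {a : Fin (N + 1) → C} {t : Fin (M + 1) → C} {s : Fin (L + 1) → C}
    {d' d'' : C} (g : Grafting c b d' a) (g' : Grafting a f d'' t)
    (h : Grafting c s d' t) (h' : Grafting b f d'' s), Grafting.Sequential g g' h h' →
    ∀ {d : C} {p q r pq qr pqr : ℤ} (hpq : p + q = pq) (hqr : q + r = qr) (h₁ : pq + r = pqr)
      (h₂ : p + qr = pqr) (x : obj m c d p) (y : obj n b d' q) (z : obj l f d'' r),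
      comp g' h₁ (comp g hpq x y) z = comp h h₂ x (comp h' hqr y z)
  /-- `(x ∘ y) ∘ z = (-1)^{|y||z|} (x ∘ z) ∘ y`, when `y` and `z` are plugged into `x`. -/
  comp_parallel : ∀ {m n l N M L : ℕ} {c : Fin (m + 1) → C} {b : Fin (n + 1) → C}
    {f : Fin (l + 1) → C} {a : Fin (N + 1) → C} {t : Fin (M + 1) → C} {s : Fin (L + 1) → C}
    {d' d'' : C} (g : Grafting c b d' a) (g' : Grafting a f d'' t)
    (h : Grafting c f d'' s) (h' : Grafting s b d' t), Grafting.Parallel g g' h h' →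
    ∀ {d : C} {p q r pq pr pqr : ℤ} (hpq : p + q = pq) (hpr : p + r = pr) (h₁ : pq + r = pqr)
      (h₂ : pr + q = pqr) (x : obj m c d p) (y : obj n b d' q) (z : obj l f d'' r),
      comp g' h₁ (comp g hpq x y) z = (q * r).negOnePow • comp h' h₂ (comp h hpr x z) y
  /-- Right unit: plugging a unit into an input of `x` gives `x`. -/
  comp_one : ∀ {m : ℕ} {c : Fin (m + 1) → C} {d' : C} (g : Grafting c (fun _ : Fin 1 => d') d' c),
    (∀ j h, g.outer j h = j) → g.inner 0 = g.slot →
    ∀ {d : C} {p : ℤ} (hr : p + 0 = p) (x : obj m c d p), comp g hr x (one d') = x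
  /-- Left unit: plugging `y` into a unit gives `y`. -/
  one_comp : ∀ {n : ℕ} {b : Fin (n + 1) → C} {d : C} (g : Grafting (fun _ : Fin 1 => d) b d b),
    (∀ j, g.inner j = j) →
    ∀ {q : ℤ} (hr : 0 + q = q) (y : obj n b d q), comp g hr (one d) y = y

namespace GradedOperad

variable {k : Type u} [CommRing k] {C : Type v}

/-- A morphism of colored operads (over the fixed set of colors). -/
structure Hom (P Q : GradedOperad.{u, v, w} k C) extends
    ColoredCollection.Hom P.toColoredCollection Q.toColoredCollection where
  map_one : ∀ d : C, map (P.one d) = Q.one d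
  map_comp : ∀ {m n N : ℕ} {c : Fin (m + 1) → C} {b : Fin (n + 1) → C} {d' : C}
    {a : Fin (N + 1) → C} (g : Grafting c b d' a) {d : C} {p q r : ℤ} (hr : p + q = r)
    (x : P.obj m c d p) (y : P.obj n b d' q),
    map (P.comp g hr x y) = Q.comp g hr (map x) (map y)

/-- The map of collections `i` exhibits `F` as the free operad on the collection `E`. -/
def IsFree {E : ColoredCollection.{u, v, w} k C} {F : GradedOperad.{u, v, w} k C}
    (i : ColoredCollection.Hom E F.toColoredCollection) : Prop :=
  ∀ (T : GradedOperad.{u, v, w} k C) (t : ColoredCollection.Hom E T.toColoredCollection),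
    ∃! φ : Hom F T, ∀ {n : ℕ} {c : Fin (n + 1) → C} {d : C} {p : ℤ} (x : E.obj n c d p),
      φ.map (i.map x) = t.map x

/-- The morphisms `i` and `j` exhibit `R` as the coproduct (free product) of `S` and `F`. -/
def IsCoproduct {S F R : GradedOperad.{u, v, w} k C} (i : Hom S R) (j : Hom F R) : Prop :=
  ∀ (T : GradedOperad.{u, v, w} k C) (s : Hom S T) (t : Hom F T),
    ∃! φ : Hom R T,
      (∀ {n : ℕ} {c : Fin (n + 1) → C} {d : C} {p : ℤ} (x : S.obj n c d p),
        φ.map (i.map x) = s.map x) ∧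
      (∀ {n : ℕ} {c : Fin (n + 1) → C} {d : C} {p : ℤ} (x : F.obj n c d p),
        φ.map (j.map x) = t.map x)

/-- Membership in the suboperad of `P` generated by a family of subsets `A`. -/
inductive Generated (P : GradedOperad.{u, v, w} k C)
    (A : ∀ (n : ℕ) (c : Fin (n + 1) → C) (d : C) (p : ℤ), Set (P.obj n c d p)) :
    ∀ {n : ℕ} {c : Fin (n + 1) → C} {d : C} {p : ℤ}, P.obj n c d p → Prop
  | of {n : ℕ} {c : Fin (n + 1) → C} {d : C} {p : ℤ} (x : P.obj n c d p) (hx : x ∈ A n c d p) :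
      Generated P A x
  | zero {n : ℕ} {c : Fin (n + 1) → C} {d : C} {p : ℤ} : Generated P A (0 : P.obj n c d p)
  | add {n : ℕ} {c : Fin (n + 1) → C} {d : C} {p : ℤ} (x y : P.obj n c d p) :
      Generated P A x → Generated P A y → Generated P A (x + y)
  | smul {n : ℕ} {c : Fin (n + 1) → C} {d : C} {p : ℤ} (r : k) (x : P.obj n c d p) :
      Generated P A x → Generated P A (r • x)
  | act {n : ℕ} (σ : Equiv.Perm (Fin (n + 1))) {c c' : Fin (n + 1) → C} {d : C} {p : ℤ}
      (h : ∀ j, c' j = c (σ j)) (x : P.obj n c d p) :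
      Generated P A x → Generated P A (P.act σ h x)
  | one (d : C) : Generated P A (P.one d)
  | comp {m n N : ℕ} {c : Fin (m + 1) → C} {b : Fin (n + 1) → C} {d' : C} {a : Fin (N + 1) → C}
      (g : Grafting c b d' a) {d : C} {p q r : ℤ} (hr : p + q = r)
      (x : P.obj m c d p) (y : P.obj n b d' q) :
      Generated P A x → Generated P A y → Generated P A (P.comp g hr x y)

end GradedOperad

/-- A differential `C`-colored operad: a `C`-colored operad in chain complexes of `k`-modules. -/
structure DGOperad (k : Type u) [CommRing k] (C : Type v) extends GradedOperad.{u, v, w} k C where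
  /-- The differential, of degree `-1`. -/
  diff : ∀ {n : ℕ} {c : Fin (n + 1) → C} {d : C} {p p' : ℤ}, p' + 1 = p →
    (obj n c d p →ₗ[k] obj n c d p')
  diff_diff : ∀ {n : ℕ} {c : Fin (n + 1) → C} {d : C} {p p' p'' : ℤ} (h : p' + 1 = p)
    (h' : p'' + 1 = p') (x : obj n c d p), diff h' (diff h x) = 0
  diff_act : ∀ {n : ℕ} (σ : Equiv.Perm (Fin (n + 1))) {c c' : Fin (n + 1) → C} {d : C} {p p' : ℤ}
    (h : p' + 1 = p) (hσ : ∀ j, c' j = c (σ j)) (x : obj n c d p),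
    diff h (act σ hσ x) = act σ hσ (diff h x)
  diff_one : ∀ {p' : ℤ} (h : p' + 1 = 0) (d : C), diff h (one d) = 0
  /-- `∂(x ∘ y) = ∂x ∘ y + (-1)^{|x|} x ∘ ∂y`. -/
  diff_comp : ∀ {m n N : ℕ} {c : Fin (m + 1) → C} {b : Fin (n + 1) → C} {d' : C}
    {a : Fin (N + 1) → C} (g : Grafting c b d' a) {d : C} {p q r p' q' r' : ℤ}
    (hp : p' + 1 = p) (hq : q' + 1 = q) (hr : r' + 1 = r)
    (h : p + q = r) (h₁ : p' + q = r') (h₂ : p + q' = r')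
    (x : obj m c d p) (y : obj n b d' q),
    diff hr (comp g h x y) = comp g h₁ (diff hp x) y + p.negOnePow • comp g h₂ x (diff hq y)

namespace DGOperad

variable {k : Type u} [CommRing k] {C : Type v}

/-- A map of differential colored operads (over the fixed set of colors). -/
structure Hom (P Q : DGOperad.{u, v, w} k C) extends
    toGradedHom : GradedOperad.Hom P.toGradedOperad Q.toGradedOperad where
  map_diff : ∀ {n : ℕ} {c : Fin (n + 1) → C} {d : C} {p p' : ℤ} (h : p' + 1 = p)
    (x : P.obj n c d p), map (P.diff h x) = Q.diff h (map x)

/-- The composite `β ∘ α` of maps of differential operads. -/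
def Hom.comp {P Q R : DGOperad.{u, v, w} k C} (β : Hom Q R) (α : Hom P Q) : Hom P R where
  map := β.map ∘ₗ α.map
  map_act σ _ _ _ _ h x := by simp [α.map_act, β.map_act]
  map_one d := by simp [α.map_one, β.map_one]
  map_comp g _ _ _ _ hr x y := by simp [α.map_comp, β.map_comp]
  map_diff h x := by simp [α.map_diff, β.map_diff]

/-- Cycles in degree `p`. -/
def cycles (P : DGOperad.{u, v, w} k C) (n : ℕ) (c : Fin (n + 1) → C) (d : C) (p : ℤ) :
    Submodule k (P.obj n c d p) :=
  LinearMap.ker (P.diff (sub_add_cancel p 1) : P.obj n c d p →ₗ[k] P.obj n c d (p - 1))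

/-- Boundaries in degree `p`, as a submodule of the cycles. -/
def boundaries (P : DGOperad.{u, v, w} k C) (n : ℕ) (c : Fin (n + 1) → C) (d : C) (p : ℤ) :
    Submodule k (P.cycles n c d p) :=
  (LinearMap.range (P.diff rfl : P.obj n c d (p + 1) →ₗ[k] P.obj n c d p)).comap
    (P.cycles n c d p).subtype

/-- The homology of the component with inputs `c` and output `d`, in degree `p`. -/
abbrev homology (P : DGOperad.{u, v, w} k C) (n : ℕ) (c : Fin (n + 1) → C) (d : C) (p : ℤ) :
    Type (max u v w) :=
  P.cycles n c d p ⧸ P.boundaries n c d p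

/-- The map induced on cycles. -/
def Hom.mapCycles {P Q : DGOperad.{u, v, w} k C} (α : Hom P Q) (n : ℕ) (c : Fin (n + 1) → C)
    (d : C) (p : ℤ) : P.cycles n c d p →ₗ[k] Q.cycles n c d p :=
  α.map.restrict fun x hx => by
    have hx' : P.diff (sub_add_cancel p 1) x = 0 := hx
    change Q.diff (sub_add_cancel p 1) (α.map x) = 0
    rw [← α.map_diff, hx', map_zero]

/-- The map induced on homology. -/
def Hom.mapHomology {P Q : DGOperad.{u, v, w} k C} (α : Hom P Q) (n : ℕ) (c : Fin (n + 1) → C)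
    (d : C) (p : ℤ) : P.homology n c d p →ₗ[k] Q.homology n c d p :=
  Submodule.mapQ _ _ (α.mapCycles n c d p) <| by
    rintro ⟨x, hx⟩ ⟨y, hy⟩
    exact ⟨α.map y, (α.map_diff _ _).symm.trans (congrArg α.map hy)⟩

/-- `α` is a homology isomorphism. -/
def Hom.IsHomologyIso {P Q : DGOperad.{u, v, w} k C} (α : Hom P Q) : Prop :=
  ∀ (n : ℕ) (c : Fin (n + 1) → C) (d : C) (p : ℤ), Function.Bijective (α.mapHomology n c d p)

/-- `ι : S → R` is an elemental cofibration: up to isomorphism it is the inclusion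
`(S, ∂) → (S * Γ(E), ∂)`, where `Γ(E)` is the free graded operad on a collection `E = ⨁ₛ Eₛ`, and
`∂(Eₛ)` is contained in `S * Γ(E)_{<s}`, the suboperad generated by `S` and the `Eₜ` with `t < s`. -/
def Hom.IsElementalCofibration {S R : DGOperad.{u, v, w} k C} (ι : Hom S R) : Prop :=
  ∃ (E : ℕ → ColoredCollection.{u, v, w} k C) (F : GradedOperad.{u, v, w} k C)
    (i : ColoredCollection.Hom (ColoredCollection.directSum E) F.toColoredCollection)
    (j : GradedOperad.Hom F R.toGradedOperad),
    GradedOperad.IsFree i ∧ GradedOperad.IsCoproduct ι.toGradedHom j ∧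
    ∀ (s : ℕ) (n : ℕ) (c : Fin (n + 1) → C) (d : C) (p p' : ℤ) (h : p' + 1 = p)
      (e : (E s).obj n c d p),
      R.Generated
        (fun n c d p => Set.range (fun x : S.obj n c d p => ι.map x) ∪
          {y | ∃ t < s, ∃ e' : (E t).obj n c d p,
            y = j.map (i.map ((ColoredCollection.directSumIncl E t).map e'))})
        (R.diff h (j.map (i.map ((ColoredCollection.directSumIncl E s).map e))))

theorem fin_one_eq (i j : Fin (0 + 1)) : i = j :=
  Subsingleton.elim (α := Fin 1) i j

/-- The profile and degree of the units: one input, of the same color as the output, degree `0`. -/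
def IsUnitIndex (n : ℕ) (c : Fin (n + 1) → C) (d : C) (p : ℤ) : Prop :=
  n = 0 ∧ c 0 = d ∧ p = 0

theorem IsUnitIndex.act {n : ℕ} (σ : Equiv.Perm (Fin (n + 1))) {c c' : Fin (n + 1) → C} {d : C}
    {p : ℤ} (h : ∀ j, c' j = c (σ j)) (H : IsUnitIndex n c d p) : IsUnitIndex n c' d p := by
  obtain ⟨rfl, hc, rfl⟩ := H
  refine ⟨rfl, ?_, rfl⟩
  rw [h, ← hc, fin_one_eq (σ 0) 0]

theorem IsUnitIndex.comp {m n N : ℕ} {c : Fin (m + 1) → C} {b : Fin (n + 1) → C} {d' : C}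
    {a : Fin (N + 1) → C} (g : Grafting c b d' a) {d : C} {p q r : ℤ} (hr : p + q = r)
    (H : IsUnitIndex m c d p) (H' : IsUnitIndex n b d' q) : IsUnitIndex N a d r := by
  have hN := g.arity_eq
  obtain ⟨rfl, hc, rfl⟩ := H
  obtain ⟨rfl, hb, rfl⟩ := H'
  subst hN
  refine ⟨rfl, ?_, by omega⟩
  have h1 := g.color_inner 0
  have h2 := g.color_slot
  rw [fin_one_eq g.slot 0] at h2
  rw [← hc, h2, ← hb, ← h1]
  exact congrArg a (fin_one_eq _ _)

/-- The component of the trivial operad: `k` in the profiles and degree of the units, and `0`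
otherwise (a copy of `k` lifted to the common universe). -/
def trivialObj (k : Type u) [CommRing k] {C : Type v} (n : ℕ) (c : Fin (n + 1) → C) (d : C)
    (p : ℤ) : Submodule k (ULift.{max v w} k) where
  carrier := {x | ¬ IsUnitIndex n c d p → x = 0}
  zero_mem' _ := rfl
  add_mem' hx hy h := by rw [hx h, hy h, add_zero]
  smul_mem' r _ hx h := by rw [hx h, smul_zero]

theorem trivialObj_mul_mem {m n N : ℕ} {c : Fin (m + 1) → C} {b : Fin (n + 1) → C} {d' : C}
    {a : Fin (N + 1) → C} (g : Grafting c b d' a) {d : C} {p q r : ℤ} (hr : p + q = r)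
    {x y : ULift.{max v w} k} (hx : x ∈ trivialObj.{u, v, w} k m c d p)
    (hy : y ∈ trivialObj.{u, v, w} k n b d' q) : x * y ∈ trivialObj.{u, v, w} k N a d r := by
  intro h
  by_cases H : IsUnitIndex m c d p
  · by_cases H' : IsUnitIndex n b d' q
    · exact absurd (H.comp g hr H') h
    · rw [hy H', mul_zero]
  · rw [hx H, zero_mul]

/-- The trivial (initial) operad `𝟏`: `k` in the components with one input, of the same color as the
output, in degree `0`, and zero otherwise; composition is multiplication in `k`. -/
def trivialOperad (k : Type u) [CommRing k] (C : Type v) : DGOperad.{u, v, w} k C where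
  obj n c d p := trivialObj.{u, v, w} k n c d p
  act σ c c' d p h :=
    { toFun := fun x => ⟨x.1, fun H => x.2 fun H' => H (H'.act σ h)⟩
      map_add' := fun _ _ => rfl
      map_smul' := fun _ _ => rfl }
  act_one := by intros; rfl
  act_mul := by intros; rfl
  one d := ⟨1, fun H => absurd ⟨rfl, rfl, rfl⟩ H⟩
  comp g _ _ _ _ hr := LinearMap.mk₂ k
    (fun x y => ⟨x.1 * y.1, trivialObj_mul_mem g hr x.2 y.2⟩)
    (fun _ _ _ => Subtype.ext (add_mul _ _ _))
    (fun _ _ _ => Subtype.ext (smul_mul_assoc _ _ _))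
    (fun _ _ _ => Subtype.ext (mul_add _ _ _))
    (fun _ _ _ => Subtype.ext (mul_smul_comm _ _ _))
  act_comp := by intros; rfl
  comp_act := by intros; rfl
  comp_sequential := by
    intros
    exact Subtype.ext (mul_assoc _ _ _)
  comp_parallel := by
    intro m n l N M L c b f a t s d' d'' g g' h h' _ d p q r pq pr pqr hpq hpr h₁ h₂ x y z
    by_cases hq : q = 0
    · subst hq
      rw [zero_mul, Int.negOnePow_zero, one_smul]
      exact Subtype.ext (mul_right_comm _ _ _)
    · have hy : y = 0 := Subtype.ext (y.2 fun H => hq H.2.2)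
      rw [hy, map_zero, map_zero, LinearMap.zero_apply, map_zero, smul_zero]
  comp_one := by
    intros
    exact Subtype.ext (mul_one _)
  one_comp := by
    intros
    exact Subtype.ext (one_mul _)
  diff _ := 0
  diff_diff := by intros; rfl
  diff_act := by intros; rfl
  diff_one := by intros; rfl
  diff_comp := by
    intros
    simp only [LinearMap.zero_apply, map_zero, smul_zero, add_zero]

open Classical in
/-- The unit of `P` in the profiles and degree of the units, and `0` otherwise. -/
noncomputable def unitElt (P : DGOperad.{u, v, w} k C) (n : ℕ) (c : Fin (n + 1) → C) (d : C)
    (p : ℤ) : P.obj n c d p :=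
  if h : IsUnitIndex n c d p then
    cast (by
      obtain ⟨rfl, hc, rfl⟩ := h
      obtain rfl : c = fun _ => d := funext fun j => by rw [fin_one_eq j 0, hc]
      rfl) (P.one d)
  else 0

theorem unitElt_one (P : DGOperad.{u, v, w} k C) (d : C) :
    P.unitElt 0 (fun _ => d) d 0 = P.one d := by
  rw [unitElt, dif_pos ⟨rfl, rfl, rfl⟩]
  rfl

theorem unitElt_act (P : DGOperad.{u, v, w} k C) {n : ℕ} (σ : Equiv.Perm (Fin (n + 1)))
    {c c' : Fin (n + 1) → C} {d : C} {p : ℤ} (h : ∀ j, c' j = c (σ j)) (H : IsUnitIndex n c d p) :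
    P.act σ h (P.unitElt n c d p) = P.unitElt n c' d p := by
  obtain ⟨rfl, hc, rfl⟩ := H
  obtain rfl : σ = 1 := Equiv.ext fun j => fin_one_eq _ _
  obtain rfl : c' = c := funext h
  exact P.act_one _ _

theorem unitElt_comp (P : DGOperad.{u, v, w} k C) {m n N : ℕ} {c : Fin (m + 1) → C}
    {b : Fin (n + 1) → C} {d' : C} {a : Fin (N + 1) → C} (g : Grafting c b d' a) {d : C}
    {p q r : ℤ} (hr : p + q = r) (H : IsUnitIndex m c d p) (H' : IsUnitIndex n b d' q) :
    P.comp g hr (P.unitElt m c d p) (P.unitElt n b d' q) = P.unitElt N a d r := by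
  have ha := H.comp g hr H'
  obtain ⟨rfl, hc, rfl⟩ := H
  obtain ⟨rfl, hb, rfl⟩ := H'
  obtain ⟨rfl, hA, rfl⟩ := ha
  obtain rfl : c = fun _ => d := funext fun j => by rw [fin_one_eq j 0, hc]
  obtain rfl : b = fun _ => d' := funext fun j => by rw [fin_one_eq j 0, hb]
  obtain rfl : a = fun _ => d := funext fun j => by rw [fin_one_eq j 0, hA]
  obtain rfl : d = d' := g.color_slot
  rw [unitElt_one]
  exact P.one_comp g (fun j => fin_one_eq _ _) hr _

/-- The canonical map `η : 𝟏 → P` given by the units of `P`. -/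
noncomputable def unitMap (P : DGOperad.{u, v, w} k C) : Hom (trivialOperad.{u, v, w} k C) P where
  map {n c d p} :=
    { toFun := fun x : trivialObj.{u, v, w} k n c d p => x.1.down • P.unitElt n c d p
      map_add' := fun _ _ => add_smul _ _ _
      map_smul' := fun _ _ => mul_smul _ _ _ }
  map_act := by
    intro n σ c c' d p h (x : trivialObj.{u, v, w} k n c d p)
    change x.1.down • P.unitElt n c' d p = P.act σ h (x.1.down • P.unitElt n c d p)
    by_cases H : IsUnitIndex n c d p
    · rw [map_smul, P.unitElt_act σ h H]
    · rw [x.2 H, ULift.zero_down, zero_smul, zero_smul, map_zero]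
  map_one d := by
    change (1 : k) • P.unitElt 0 (fun _ => d) d 0 = P.one d
    rw [one_smul, unitElt_one]
  map_comp := by
    intro m n N c b d' a g d p q r hr (x : trivialObj.{u, v, w} k m c d p)
      (y : trivialObj.{u, v, w} k n b d' q)
    change (x.1.down * y.1.down) • P.unitElt N a d r =
      P.comp g hr (x.1.down • P.unitElt m c d p) (y.1.down • P.unitElt n b d' q)
    by_cases H : IsUnitIndex m c d p
    · by_cases H' : IsUnitIndex n b d' q
      · rw [map_smul, map_smul, LinearMap.smul_apply, P.unitElt_comp g hr H H', smul_smul,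
          mul_comm]
      · rw [y.2 H', ULift.zero_down, mul_zero, zero_smul, zero_smul, map_zero]
    · rw [x.2 H, ULift.zero_down, zero_mul, zero_smul, zero_smul, map_zero, LinearMap.zero_apply]
  map_diff := by
    intro n c d p p' h (x : trivialObj.{u, v, w} k n c d p)
    change (0 : k) • P.unitElt n c d p' = P.diff h (x.1.down • P.unitElt n c d p)
    rw [zero_smul]
    by_cases H : IsUnitIndex n c d p
    · obtain ⟨rfl, hc, rfl⟩ := H
      obtain rfl : c = fun _ => d := funext fun j => by rw [fin_one_eq j 0, hc]
      rw [map_smul, unitElt_one, P.diff_one, smul_zero]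
    · rw [x.2 H, ULift.zero_down, zero_smul, map_zero]

/-- `P` is (elementally) cofibrant: the canonical map `𝟏 → P` is an elemental cofibration. -/
def IsElementallyCofibrant (P : DGOperad.{u, v, w} k C) : Prop :=
  P.unitMap.IsElementalCofibration

end DGOperad

/-! The model is built by a small-object style iteration. Given `α : P → Q`, consider all pairs `(z,
q)` where `z` is a cycle of `P` and `q` is an element of `Q` with `∂q = α z`. Attach to `P` one
generator for each pair, with boundary `z`, and extend `α` by sending the generator to `q`. Since
every pair is used, these pairs form a collection: they are closed under linear combinations and
under the symmetric groups, and no equivariant choice of representatives is made. Starting from `f :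
S → Q` and repeating this countably often gives stages `S = R₀ → R₁ → ⋯` over `Q`, and `R` is their
colimit.

The map `R → Q` is a homology isomorphism for two reasons. The pairs `(0, q)` with `q` a cycle of
`Q` already make it surjective on homology at the first step. A cycle of `R` whose image bounds some
`q` comes from a cycle `y` of a stage `Rₛ`, and the cell `(y, q)` attached to `Rₛ` makes it a
boundary in `Rₛ₊₁` (`exists_diff_eq_ofStage`, `isHomologyIso_modelProj`).

The inclusion `S → R` is an elemental cofibration with `Eₛ` the cells attached to `Rₛ`. Maps out of
`R` are determined stage by stage by their values on `S` and on the cells, which is the universal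
property of `S * Γ(⨁ Eₛ)` (`isCoproduct_model`). The boundary of a cell of `Eₛ` lies in the image of
`Rₛ`, which is generated by `S` and the `Eₜ` with `t < s` (`generated_ofStage`).

The ingredients are built by universal properties rather than by trees. The operad `P * Γ(E)` is a
quotient of formal expressions. Its differential is a morphism to dual numbers, so it exists by the
lifting property. The colimit consists of eventually coherent sequences modulo eventually zero ones.
-/

namespace ColoredCollection

variable {k : Type u} [CommRing k] {C : Type v}

/-- Transport along an equality of degrees. -/
def degCast (E : ColoredCollection.{u, v, w} k C) {n : ℕ} {c : Fin (n + 1) → C} {d : C} {p q : ℤ}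
    (h : p = q) : E.obj n c d p →ₗ[k] E.obj n c d q :=
  h ▸ LinearMap.id

end ColoredCollection

theorem LinearMap.map_intUnits_smul {k M N : Type*} [CommRing k] [AddCommGroup M] [Module k M]
    [AddCommGroup N] [Module k N] (f : M →ₗ[k] N) (a : ℤˣ) (x : M) : f (a • x) = a • f x := by
  rw [Units.smul_def, Units.smul_def, map_zsmul]

theorem LinearMap.intUnits_smul_apply {k M N : Type*} [CommRing k] [AddCommGroup M] [Module k M]
    [AddCommGroup N] [Module k N] (f : M →ₗ[k] N) (a : ℤˣ) (x : M) : (a • f) x = a • f x := by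
  rw [Units.smul_def, Units.smul_def, LinearMap.smul_apply]

/-! ### Dual numbers and derivations. -/

namespace GradedOperad

variable {k : Type u} [CommRing k] {C : Type v}

/-- The operad `P[ε]` of dual numbers over `P`, where `ε` has degree `1` and square zero: the
morphisms `P → P[ε]` that lift the identity are the derivations of `P` of degree `-1`. -/
def dual (P : GradedOperad.{u, v, w} k C) : GradedOperad.{u, v, w} k C where
  obj n c d p := P.obj n c d p × P.obj n c d (p - 1)
  act σ _ _ _ _ h := (P.act σ h).prodMap (P.act σ h)
  act_one h x := Prod.ext (P.act_one h _) (P.act_one h _)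
  act_mul σ τ _ _ _ _ _ h h' h'' x :=
    Prod.ext (P.act_mul σ τ h h' h'' _) (P.act_mul σ τ h h' h'' _)
  one d := (P.one d, 0)
  -- A pair stands for `x.1 + ε x.2`. The sign comes from moving `ε`, of degree `1`, past `x.1`, of
  -- degree `p`; the product of the two `ε`-parts vanishes. Read in the second component,
  -- multiplicativity is the graded Leibniz rule.
  comp g d p q r hr := LinearMap.mk₂ k
    (fun x y => (P.comp g hr x.1 y.1,
      P.comp g (by omega) x.2 y.1 + p.negOnePow • P.comp g (by omega) x.1 y.2))
    (fun x x' y => Prod.ext (by simp) (by simp; abel))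
    (fun a x y => Prod.ext (by simp) (by simp [smul_comm a p.negOnePow]))
    (fun x y y' => Prod.ext (by simp) (by simp; abel))
    (fun a x y => Prod.ext (by simp) (by simp [smul_comm a p.negOnePow]))
  act_comp g g' σ hσ h₁ h₂ h₃ d p q r hr x y := by
    have key := fun {p q r : ℤ} => P.act_comp g g' σ hσ h₁ h₂ h₃ (d := d) (p := p) (q := q) (r := r)
    refine Prod.ext (key _ _ _) ?_
    simp [key]
  comp_act g g' σ hσ τ hτ h₁ h₂ h₃ d p q r hr x y := by
    have key := fun {p q r : ℤ} =>
      P.comp_act g g' σ hσ τ hτ h₁ h₂ h₃ (d := d) (p := p) (q := q) (r := r)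
    refine Prod.ext (key _ _ _) ?_
    simp [key]
  comp_sequential g g' h h' H d p q r pq qr pqr hpq hqr h₁ h₂ x y z := by
    have key := fun {p q r pq qr pqr : ℤ} => P.comp_sequential g g' h h' H (d := d)
      (p := p) (q := q) (r := r) (pq := pq) (qr := qr) (pqr := pqr)
    refine Prod.ext (key _ _ _ _ _ _ _) ?_
    simp only [LinearMap.mk₂_apply, map_add, LinearMap.add_apply, LinearMap.map_intUnits_smul,
      LinearMap.intUnits_smul_apply]
    have e : pq.negOnePow = p.negOnePow * q.negOnePow := by rw [← hpq, Int.negOnePow_add]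
    rw [key (pq := pq - 1) (qr := qr) _ hqr _ (by omega),
      key (qr := qr - 1) _ (by omega) _ (by omega), key hpq (qr := qr - 1) (by omega) _ (by omega), e, mul_smul, smul_add,
      add_assoc]
  comp_parallel g g' h h' H d p q r pq pr pqr hpq hpr h₁ h₂ x y z := by
    have key := fun {p q r pq pr pqr : ℤ} => P.comp_parallel g g' h h' H (d := d)
      (p := p) (q := q) (r := r) (pq := pq) (pr := pr) (pqr := pqr)
    refine Prod.ext (key _ _ _ _ _ _ _) ?_
    simp only [LinearMap.mk₂_apply, map_add, LinearMap.add_apply, LinearMap.map_intUnits_smul,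
      LinearMap.intUnits_smul_apply, Prod.smul_snd]
    rw [key (pq := pq - 1) (pr := pr - 1) _ (by omega) _ (by omega),
      key (pq := pq - 1) (pr := pr) _ hpr _ (by omega),
      key hpq (pr := pr - 1) (by omega) _ (by omega)]
    simp only [smul_add, smul_smul, ← Int.negOnePow_add]
    -- The `ε`-part of `y` has degree `q - 1`, so interchanging it with `z` costs a different Koszul
    -- sign; the discrepancy `(-1)^r` is that of moving `ε` past `z`. The next identity does the
    -- same for the `ε`-part of `z`, which must pass `y`.
    have e₁ : (p + (q - 1) * r).negOnePow = (q * r + pr).negOnePow := by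
      rw [Int.negOnePow_eq_iff, ← hpr]
      exact ⟨-r, by ring⟩
    have e₂ : (pq + q * (r - 1)).negOnePow = (q * r + p).negOnePow := by
      rw [Int.negOnePow_eq_iff, ← hpq]
      exact ⟨0, by ring⟩
    rw [e₁, e₂]
    abel
  comp_one g h₁ h₂ d p hr x := by
    refine Prod.ext (P.comp_one g h₁ h₂ _ _) ?_
    simp [P.comp_one g h₁ h₂]
  one_comp g h₁ q hr x := by
    refine Prod.ext (P.one_comp g h₁ _ _) ?_
    simp [P.one_comp g h₁]

theorem Hom.ext' {P Q : GradedOperad.{u, v, w} k C} {φ ψ : Hom P Q}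
    (h : ∀ {n : ℕ} {c : Fin (n + 1) → C} {d : C} {p : ℤ} (x : P.obj n c d p),
      φ.map x = ψ.map x) : φ = ψ := by
  obtain ⟨⟨f, _⟩, _, _⟩ := φ
  obtain ⟨⟨g, _⟩, _, _⟩ := ψ
  obtain rfl : @f = @g := by
    funext n c d p
    exact LinearMap.ext h
  rfl

/-- The identity morphism. -/
def Hom.id (P : GradedOperad.{u, v, w} k C) : Hom P P where
  map := LinearMap.id
  map_act _ _ _ _ _ _ _ := rfl
  map_one _ := rfl
  map_comp _ _ _ _ _ _ _ _ := rfl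

/-- The composite `ψ ∘ φ` of morphisms of graded operads. -/
def Hom.comp {P Q R : GradedOperad.{u, v, w} k C} (ψ : Hom Q R) (φ : Hom P Q) : Hom P R where
  map := ψ.map ∘ₗ φ.map
  map_act σ _ _ _ _ h x := by simp [φ.map_act, ψ.map_act]
  map_one d := by simp [φ.map_one, ψ.map_one]
  map_comp g _ _ _ _ hr x y := by simp [φ.map_comp, ψ.map_comp]

/-- The projection `P[ε] → P`. -/
def dualFst (P : GradedOperad.{u, v, w} k C) : Hom P.dual P where
  map {n c d p} := LinearMap.fst k (P.obj n c d p) (P.obj n c d (p - 1))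
  map_act _ _ _ _ _ _ _ := rfl
  map_one _ := rfl
  map_comp _ _ _ _ _ _ _ _ := rfl

end GradedOperad

/-! ### Free adjunction of a collection: the operad `P * Γ(E)`. -/

namespace GradedOperad

variable {k : Type u} [CommRing k] {C : Type v}

/-- Formal expressions in the operations of an operad, with the elements of the operad `P` and of
the collection `E` as constants. -/
inductive Term (P : GradedOperad.{u, v, w} k C) (E : ColoredCollection.{u, v, w} k C) :
    ∀ n : ℕ, (Fin (n + 1) → C) → C → ℤ → Type (max u v w)
  | base {n : ℕ} {c : Fin (n + 1) → C} {d : C} {p : ℤ} (x : P.obj n c d p) : Term P E n c d p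
  | cell {n : ℕ} {c : Fin (n + 1) → C} {d : C} {p : ℤ} (e : E.obj n c d p) : Term P E n c d p
  | add {n : ℕ} {c : Fin (n + 1) → C} {d : C} {p : ℤ} (x y : Term P E n c d p) : Term P E n c d p
  | smul {n : ℕ} {c : Fin (n + 1) → C} {d : C} {p : ℤ} (r : k) (x : Term P E n c d p) :
      Term P E n c d p
  | act {n : ℕ} (σ : Equiv.Perm (Fin (n + 1))) {c c' : Fin (n + 1) → C} {d : C} {p : ℤ}
      (h : ∀ j, c' j = c (σ j)) (x : Term P E n c d p) : Term P E n c' d p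
  | comp {m n N : ℕ} {c : Fin (m + 1) → C} {b : Fin (n + 1) → C} {d' : C} {a : Fin (N + 1) → C}
      (g : Grafting c b d' a) {d : C} {p q r : ℤ} (hr : p + q = r) (x : Term P E m c d p)
      (y : Term P E n b d' q) : Term P E N a d r

section Adjoin

variable {P : GradedOperad.{u, v, w} k C} {E : ColoredCollection.{u, v, w} k C}

/-- The value of a formal expression in an operad `T`. -/
def Term.eval {T : GradedOperad.{u, v, w} k C} (φ : Hom P T)
    (t : ColoredCollection.Hom E T.toColoredCollection) {n : ℕ} {c : Fin (n + 1) → C} {d : C}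
    {p : ℤ} : Term P E n c d p → T.obj n c d p
  | .base x => φ.map x
  | .cell e => t.map e
  | .add x y => x.eval φ t + y.eval φ t
  | .smul r x => r • x.eval φ t
  | .act σ h x => T.act σ h (x.eval φ t)
  | .comp g hr x y => T.comp g hr (x.eval φ t) (y.eval φ t)

/-- Two expressions are equivalent when they have the same value in every operad. -/
def termSetoid (P : GradedOperad.{u, v, w} k C) (E : ColoredCollection.{u, v, w} k C) (n : ℕ)
    (c : Fin (n + 1) → C) (d : C) (p : ℤ) : Setoid (Term P E n c d p) where
  -- The quantifier over all operads `T` sits inside a proposition, so the quotient stays in the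
  -- universe of the expressions.
  r x y := ∀ (T : GradedOperad.{u, v, w} k C) (φ : Hom P T)
    (t : ColoredCollection.Hom E T.toColoredCollection), x.eval φ t = y.eval φ t
  iseqv := ⟨fun _ _ _ _ => rfl, fun h T φ t => (h T φ t).symm,
    fun h h' T φ t => (h T φ t).trans (h' T φ t)⟩

/-- The components of the coproduct of `P` and the free operad on `E`. -/
def AdjoinObj (P : GradedOperad.{u, v, w} k C) (E : ColoredCollection.{u, v, w} k C) (n : ℕ)
    (c : Fin (n + 1) → C) (d : C) (p : ℤ) : Type (max u v w) :=
  Quotient (termSetoid P E n c d p)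

namespace AdjoinObj

variable {n : ℕ} {c : Fin (n + 1) → C} {d : C} {p : ℤ}

/-- The value in `T` of an element of the coproduct of `P` and the free operad on `E`. -/
def eval {T : GradedOperad.{u, v, w} k C} (φ : Hom P T)
    (t : ColoredCollection.Hom E T.toColoredCollection) : AdjoinObj P E n c d p → T.obj n c d p :=
  Quotient.lift (Term.eval φ t) fun _ _ h => h T φ t

/-- Elements are separated by their values in operads. Hence every module or operad axiom for the
quotient follows from the same axiom in each target `T`, with no list of relations to generate the
congruence. -/
theorem ext {x y : AdjoinObj P E n c d p}
    (h : ∀ (T : GradedOperad.{u, v, w} k C) (φ : Hom P T)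
      (t : ColoredCollection.Hom E T.toColoredCollection), x.eval φ t = y.eval φ t) : x = y := by
  induction x using Quotient.ind
  induction y using Quotient.ind
  exact Quotient.sound h

instance : Zero (AdjoinObj P E n c d p) := ⟨⟦.base 0⟧⟩

instance : Add (AdjoinObj P E n c d p) :=
  ⟨Quotient.map₂ .add fun _ _ h _ _ h' T φ t => congrArg₂ (· + ·) (h T φ t) (h' T φ t)⟩

instance : SMul k (AdjoinObj P E n c d p) :=
  ⟨fun r => Quotient.map (.smul r) fun _ _ h T φ t => congrArg (r • ·) (h T φ t)⟩

instance : Neg (AdjoinObj P E n c d p) := ⟨fun x => (-1 : k) • x⟩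

section

variable {T : GradedOperad.{u, v, w} k C} (φ : Hom P T)
  (t : ColoredCollection.Hom E T.toColoredCollection)

theorem eval_zero : (0 : AdjoinObj P E n c d p).eval φ t = 0 :=
  map_zero φ.map

theorem eval_add (x y : AdjoinObj P E n c d p) :
    (x + y).eval φ t = x.eval φ t + y.eval φ t := by
  induction x using Quotient.ind
  induction y using Quotient.ind
  rfl

theorem eval_smul (r : k) (x : AdjoinObj P E n c d p) :
    (r • x).eval φ t = r • x.eval φ t := by
  induction x using Quotient.ind
  rfl

theorem eval_neg (x : AdjoinObj P E n c d p) : (-x).eval φ t = -x.eval φ t :=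
  (eval_smul φ t _ x).trans (neg_one_smul k _)

end

instance : AddCommGroup (AdjoinObj P E n c d p) where
  add_assoc x y z := ext fun T φ t => by simp only [eval_add, add_assoc]
  zero_add x := ext fun T φ t => by simp only [eval_add, eval_zero, zero_add]
  add_zero x := ext fun T φ t => by simp only [eval_add, eval_zero, add_zero]
  nsmul := nsmulRec
  zsmul := zsmulRec
  neg_add_cancel x := ext fun T φ t => by
    simp only [eval_add, eval_zero, eval_neg, neg_add_cancel]
  add_comm x y := ext fun T φ t => by simp only [eval_add, add_comm]

instance : Module k (AdjoinObj P E n c d p) where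
  one_smul x := ext fun T φ t => by simp only [eval_smul, one_smul]
  mul_smul a b x := ext fun T φ t => by simp only [eval_smul, mul_smul]
  smul_zero a := ext fun T φ t => by simp only [eval_smul, eval_zero, smul_zero]
  smul_add a x y := ext fun T φ t => by simp only [eval_smul, eval_add, smul_add]
  add_smul a b x := ext fun T φ t => by simp only [eval_smul, eval_add, add_smul]
  zero_smul x := ext fun T φ t => by simp only [eval_smul, eval_zero, zero_smul]

/-- Evaluation as a linear map. -/
def evalₗ {T : GradedOperad.{u, v, w} k C} (φ : Hom P T)
    (t : ColoredCollection.Hom E T.toColoredCollection) :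
    AdjoinObj P E n c d p →ₗ[k] T.obj n c d p where
  toFun := eval φ t
  map_add' := eval_add φ t
  map_smul' := eval_smul φ t

theorem eval_intUnits_smul {T : GradedOperad.{u, v, w} k C} (φ : Hom P T)
    (t : ColoredCollection.Hom E T.toColoredCollection) (a : ℤˣ) (x : AdjoinObj P E n c d p) :
    (a • x).eval φ t = a • x.eval φ t :=
  (evalₗ φ t).map_intUnits_smul a x

/-- The action of a permutation. -/
def act (σ : Equiv.Perm (Fin (n + 1))) {c c' : Fin (n + 1) → C} (h : ∀ j, c' j = c (σ j))
    (x : AdjoinObj P E n c d p) : AdjoinObj P E n c' d p :=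
  Quotient.map (.act σ h) (fun _ _ H T φ t => by exact congrArg (T.act σ h) (H T φ t)) x

/-- Partial composition. -/
def comp {m n N : ℕ} {c : Fin (m + 1) → C} {b : Fin (n + 1) → C} {d' : C} {a : Fin (N + 1) → C}
    (g : Grafting c b d' a) {d : C} {p q r : ℤ} (hr : p + q = r) (x : AdjoinObj P E m c d p)
    (y : AdjoinObj P E n b d' q) : AdjoinObj P E N a d r :=
  Quotient.map₂ (.comp g hr)
    (fun _ _ H _ _ H' T φ t => by
      exact congrArg₂ (fun x y => T.comp g hr x y) (H T φ t) (H' T φ t)) x y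

theorem eval_act {T : GradedOperad.{u, v, w} k C} (φ : Hom P T)
    (t : ColoredCollection.Hom E T.toColoredCollection) (σ : Equiv.Perm (Fin (n + 1)))
    {c c' : Fin (n + 1) → C} (h : ∀ j, c' j = c (σ j)) (x : AdjoinObj P E n c d p) :
    (x.act σ h).eval φ t = T.act σ h (x.eval φ t) := by
  induction x using Quotient.ind
  rfl

theorem eval_comp {T : GradedOperad.{u, v, w} k C} (φ : Hom P T)
    (t : ColoredCollection.Hom E T.toColoredCollection) {m n N : ℕ} {c : Fin (m + 1) → C}
    {b : Fin (n + 1) → C} {d' : C} {a : Fin (N + 1) → C}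
    (g : Grafting c b d' a) {d : C} {p q r : ℤ} (hr : p + q = r) (x : AdjoinObj P E m c d p)
    (y : AdjoinObj P E n b d' q) :
    (comp g hr x y).eval φ t = T.comp g hr (x.eval φ t) (y.eval φ t) := by
  induction x using Quotient.ind
  induction y using Quotient.ind
  rfl

end AdjoinObj

open AdjoinObj in
/-- The coproduct of `P` and the free operad on `E`. -/
def adjoin (P : GradedOperad.{u, v, w} k C) (E : ColoredCollection.{u, v, w} k C) :
    GradedOperad.{u, v, w} k C where
  obj := AdjoinObj P E
  act σ _ _ _ _ h :=
    { toFun := AdjoinObj.act σ h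
      map_add' := fun x y => ext fun T φ t => by simp only [eval_act, eval_add, map_add]
      map_smul' := fun r x => ext fun T φ t => by
        simp only [eval_act, eval_smul, map_smul, RingHom.id_apply] }
  act_one h x := ext fun T φ t => (eval_act φ t _ _ _).trans (T.act_one h _)
  act_mul σ τ _ _ _ _ _ h h' h'' x := ext fun T φ t => by
    simp only [LinearMap.coe_mk, AddHom.coe_mk, eval_act]
    exact T.act_mul σ τ h h' h'' _
  -- Expressions have no constructor for units: the units of `P` serve, because every morphism out
  -- of `P` preserves them.
  one d := ⟦.base (P.one d)⟧
  comp g _ _ _ _ hr := LinearMap.mk₂ k (AdjoinObj.comp g hr)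
    (fun _ _ _ => ext fun T φ t => by simp only [eval_comp, eval_add, map_add, LinearMap.add_apply])
    (fun _ _ _ => ext fun T φ t => by
      simp only [eval_comp, eval_smul, map_smul, LinearMap.smul_apply])
    (fun _ _ _ => ext fun T φ t => by simp only [eval_comp, eval_add, map_add])
    (fun _ _ _ => ext fun T φ t => by simp only [eval_comp, eval_smul, map_smul])
  act_comp g g' σ hσ h₁ h₂ h₃ d p q r hr x y := ext fun T φ t => by
    simp only [LinearMap.coe_mk, AddHom.coe_mk, LinearMap.mk₂_apply, eval_act, eval_comp]
    exact T.act_comp g g' σ hσ h₁ h₂ h₃ hr _ _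
  comp_act g g' σ hσ τ hτ h₁ h₂ h₃ d p q r hr x y := ext fun T φ t => by
    simp only [LinearMap.coe_mk, AddHom.coe_mk, LinearMap.mk₂_apply, eval_act, eval_comp]
    exact T.comp_act g g' σ hσ τ hτ h₁ h₂ h₃ hr _ _
  comp_sequential g g' h h' H d p q r pq qr pqr hpq hqr h₁ h₂ x y z := ext fun T φ t => by
    simp only [LinearMap.mk₂_apply, eval_comp]
    exact T.comp_sequential g g' h h' H hpq hqr h₁ h₂ _ _ _
  comp_parallel g g' h h' H d p q r pq pr pqr hpq hpr h₁ h₂ x y z := ext fun T φ t => by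
    simp only [LinearMap.mk₂_apply, eval_comp, eval_intUnits_smul]
    exact T.comp_parallel g g' h h' H hpq hpr h₁ h₂ _ _ _
  comp_one g h₁ h₂ d p hr x := ext fun T φ t => by
    refine (eval_comp φ t g hr x _).trans (Eq.trans ?_ (T.comp_one g h₁ h₂ hr _))
    exact congrArg _ (φ.map_one _)
  one_comp g h₁ q hr y := ext fun T φ t => by
    refine (eval_comp φ t g hr ⟦.base (P.one _)⟧ y).trans (Eq.trans ?_
      (T.one_comp g h₁ hr (y.eval φ t)))
    exact congrArg (fun x => T.comp g hr x (y.eval φ t)) (φ.map_one _)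

/-- The inclusion of `P` into its coproduct with the free operad on `E`. -/
def adjoinBase (P : GradedOperad.{u, v, w} k C) (E : ColoredCollection.{u, v, w} k C) :
    Hom P (adjoin P E) where
  map :=
    { toFun := fun x => (⟦.base x⟧ : AdjoinObj P E _ _ _ _)
      map_add' := fun x y => AdjoinObj.ext fun _ φ _ =>
        map_add φ.map x y
      map_smul' := fun r x => AdjoinObj.ext fun _ φ _ =>
        map_smul φ.map r x }
  map_act σ _ _ _ _ h x := AdjoinObj.ext fun _ φ _ => φ.map_act σ h x
  map_one _ := rfl
  map_comp g _ _ _ _ hr x y := AdjoinObj.ext fun _ φ _ => φ.map_comp g hr x y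

/-- The inclusion of `E` into the coproduct of `P` and the free operad on `E`. -/
def adjoinCell (P : GradedOperad.{u, v, w} k C) (E : ColoredCollection.{u, v, w} k C) :
    ColoredCollection.Hom E (adjoin P E).toColoredCollection where
  map :=
    { toFun := fun x => (⟦.cell x⟧ : AdjoinObj P E _ _ _ _)
      map_add' := fun x y => AdjoinObj.ext fun _ _ t =>
        map_add t.map x y
      map_smul' := fun r x => AdjoinObj.ext fun _ _ t =>
        map_smul t.map r x }
  map_act σ _ _ _ _ h x := AdjoinObj.ext fun _ _ t => t.map_act σ h x

/-- The morphism out of the coproduct given by its values on `P` and `E`. -/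
def adjoinLift {T : GradedOperad.{u, v, w} k C} (φ : Hom P T)
    (t : ColoredCollection.Hom E T.toColoredCollection) : Hom (adjoin P E) T where
  map := AdjoinObj.evalₗ φ t
  map_act σ _ _ _ _ h x := AdjoinObj.eval_act φ t σ h x
  map_one d := φ.map_one d
  map_comp g _ _ _ _ hr x y := AdjoinObj.eval_comp φ t g hr x y

/-- Every class is represented by a formal expression, so structural induction on expressions
descends to the quotient. This is generation by `P` and `E`, and gives uniqueness of morphisms. -/
theorem adjoin_induction
    {motive : ∀ {n : ℕ} {c : Fin (n + 1) → C} {d : C} {p : ℤ}, (adjoin P E).obj n c d p → Prop}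
    (base : ∀ {n : ℕ} {c : Fin (n + 1) → C} {d : C} {p : ℤ} (x : P.obj n c d p),
      motive ((adjoinBase P E).map x))
    (cell : ∀ {n : ℕ} {c : Fin (n + 1) → C} {d : C} {p : ℤ} (x : E.obj n c d p),
      motive ((adjoinCell P E).map x))
    (add : ∀ {n : ℕ} {c : Fin (n + 1) → C} {d : C} {p : ℤ} (x y : (adjoin P E).obj n c d p),
      motive x → motive y → motive (x + y))
    (smul : ∀ {n : ℕ} {c : Fin (n + 1) → C} {d : C} {p : ℤ} (r : k) (x : (adjoin P E).obj n c d p),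
      motive x → motive (r • x))
    (act : ∀ {n : ℕ} (σ : Equiv.Perm (Fin (n + 1))) {c c' : Fin (n + 1) → C} {d : C} {p : ℤ}
      (h : ∀ j, c' j = c (σ j)) (x : (adjoin P E).obj n c d p),
      motive x → motive ((adjoin P E).act σ h x))
    (comp : ∀ {m n N : ℕ} {c : Fin (m + 1) → C} {b : Fin (n + 1) → C} {d' : C}
      {a : Fin (N + 1) → C} (g : Grafting c b d' a) {d : C} {p q r : ℤ} (hr : p + q = r)
      (x : (adjoin P E).obj m c d p) (y : (adjoin P E).obj n b d' q),
      motive x → motive y → motive ((adjoin P E).comp g hr x y))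
    {n : ℕ} {c : Fin (n + 1) → C} {d : C} {p : ℤ} (x : (adjoin P E).obj n c d p) : motive x := by
  induction x using Quotient.ind with | _ x
  induction x with
  | base x => exact base x
  | cell e => exact cell e
  | add x y hx hy => exact add _ _ hx hy
  | smul r x hx => exact smul r _ hx
  | act σ h x hx => exact act σ h _ hx
  | comp g hr x y hx hy => exact comp g hr _ _ hx hy

theorem adjoin_hom_ext {T : GradedOperad.{u, v, w} k C} {φ ψ : Hom (adjoin P E) T}
    (base : ∀ {n : ℕ} {c : Fin (n + 1) → C} {d : C} {p : ℤ} (x : P.obj n c d p),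
      φ.map ((adjoinBase P E).map x) = ψ.map ((adjoinBase P E).map x))
    (cell : ∀ {n : ℕ} {c : Fin (n + 1) → C} {d : C} {p : ℤ} (x : E.obj n c d p),
      φ.map ((adjoinCell P E).map x) = ψ.map ((adjoinCell P E).map x)) : φ = ψ := by
  refine Hom.ext' fun x => ?_
  induction x using adjoin_induction with
  | base x => exact base x
  | cell x => exact cell x
  | add x y hx hy => rw [map_add, map_add, hx, hy]
  | smul r x hx => rw [map_smul, map_smul, hx]
  | act σ h x hx => rw [φ.map_act, ψ.map_act, hx]
  | comp g hr x y hx hy => rw [φ.map_comp, ψ.map_comp, hx, hy]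

end Adjoin

end GradedOperad

/-! ### Attaching cells: the differential on `P * Γ(E)`. -/

namespace DGOperad

variable {k : Type u} [CommRing k] {C : Type v}

/-- A map of degree `-1` from a collection to the cycles of an operad, along which cells can be
attached. -/
structure AttachingMap (P : DGOperad.{u, v, w} k C) (E : ColoredCollection.{u, v, w} k C) where
  map : ∀ {n : ℕ} {c : Fin (n + 1) → C} {d : C} {p : ℤ}, E.obj n c d p →ₗ[k] P.obj n c d (p - 1)
  map_act : ∀ {n : ℕ} (σ : Equiv.Perm (Fin (n + 1))) {c c' : Fin (n + 1) → C} {d : C} {p : ℤ}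
    (h : ∀ j, c' j = c (σ j)) (x : E.obj n c d p), map (E.act σ h x) = P.act σ h (map x)
  diff_map : ∀ {n : ℕ} {c : Fin (n + 1) → C} {d : C} {p : ℤ} (x : E.obj n c d p),
    P.diff (sub_add_cancel (p - 1) 1) (map x) = 0

namespace AttachingMap

variable {P : DGOperad.{u, v, w} k C} {E : ColoredCollection.{u, v, w} k C} (z : AttachingMap P E)

open GradedOperad

/-- The differential of `P`, as a morphism to dual numbers. -/
def dualBase (P : DGOperad.{u, v, w} k C) (E : ColoredCollection.{u, v, w} k C) :
    GradedOperad.Hom P.toGradedOperad (adjoin P.toGradedOperad E).dual where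
  map := (adjoinBase P.toGradedOperad E).map.prod
    ((adjoinBase P.toGradedOperad E).map ∘ₗ P.diff (sub_add_cancel _ 1))
  map_act σ _ _ _ _ h x := Prod.ext ((adjoinBase _ E).map_act σ h x) <| by
    change (adjoinBase _ E).map (P.diff _ (P.act σ h x)) = _
    rw [P.diff_act, (adjoinBase _ E).map_act]
    rfl
  map_one d := Prod.ext ((adjoinBase _ E).map_one d) <| by
    change (adjoinBase _ E).map (P.diff _ (P.one d)) = 0
    rw [P.diff_one, map_zero]
  map_comp g d p q r hr x y := Prod.ext ((adjoinBase _ E).map_comp g hr x y) <| by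
    change (adjoinBase _ E).map (P.diff _ (P.comp g hr x y)) = _
    rw [P.diff_comp g (sub_add_cancel p 1) (sub_add_cancel q 1) (sub_add_cancel r 1) hr
      (by omega) (by omega), map_add, LinearMap.map_intUnits_smul, (adjoinBase _ E).map_comp,
      (adjoinBase _ E).map_comp]
    rfl

/-- The differential of the cells, as a map to dual numbers. -/
def dualCell :
    ColoredCollection.Hom E (adjoin P.toGradedOperad E).dual.toColoredCollection where
  map := (adjoinCell P.toGradedOperad E).map.prod ((adjoinBase P.toGradedOperad E).map ∘ₗ z.map)
  map_act σ _ _ _ _ h x := Prod.ext ((adjoinCell _ E).map_act σ h x) <| by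
    change (adjoinBase _ E).map (z.map (E.act σ h x)) = _
    rw [z.map_act, (adjoinBase _ E).map_act]
    rfl

/-- The differential that extends the one of `P` and the attaching map, together with the identity,
as a morphism to dual numbers. -/
def dualHom : GradedOperad.Hom (adjoin P.toGradedOperad E) (adjoin P.toGradedOperad E).dual :=
  adjoinLift (dualBase P E) z.dualCell

/-- The derivation that extends the differential of `P` and the attaching map. -/
def derivation {n : ℕ} {c : Fin (n + 1) → C} {d : C} {p : ℤ} :
    (adjoin P.toGradedOperad E).obj n c d p →ₗ[k] (adjoin P.toGradedOperad E).obj n c d (p - 1) :=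
  LinearMap.snd k ((adjoin P.toGradedOperad E).obj n c d p)
    ((adjoin P.toGradedOperad E).obj n c d (p - 1)) ∘ₗ z.dualHom.map

/-- The projection of `dualHom` to the first factor is an endomorphism fixing `P` and `E`, hence the
identity. This is what turns its second component into a derivation. -/
theorem dualHom_fst {n : ℕ} {c : Fin (n + 1) → C} {d : C} {p : ℤ}
    (x : (adjoin P.toGradedOperad E).obj n c d p) : (z.dualHom.map x).1 = x := by
  have h : (dualFst _).comp z.dualHom = GradedOperad.Hom.id _ :=
    adjoin_hom_ext (fun _ => rfl) (fun _ => rfl)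
  exact congrArg (fun φ : GradedOperad.Hom _ _ => φ.map x) h

theorem derivation_base {n : ℕ} {c : Fin (n + 1) → C} {d : C} {p : ℤ} (x : P.obj n c d p) :
    z.derivation ((adjoinBase _ E).map x) =
      (adjoinBase _ E).map (P.diff (sub_add_cancel p 1) x) :=
  rfl

theorem derivation_cell {n : ℕ} {c : Fin (n + 1) → C} {d : C} {p : ℤ} (x : E.obj n c d p) :
    z.derivation ((adjoinCell _ E).map x) = (adjoinBase _ E).map (z.map x) :=
  rfl

theorem derivation_act {n : ℕ} (σ : Equiv.Perm (Fin (n + 1))) {c c' : Fin (n + 1) → C} {d : C}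
    {p : ℤ} (h : ∀ j, c' j = c (σ j)) (x : (adjoin P.toGradedOperad E).obj n c d p) :
    z.derivation ((adjoin _ E).act σ h x) = (adjoin _ E).act σ h (z.derivation x) :=
  congrArg Prod.snd (z.dualHom.map_act σ h x)

theorem derivation_comp {m n N : ℕ} {c : Fin (m + 1) → C} {b : Fin (n + 1) → C} {d' : C}
    {a : Fin (N + 1) → C} (g : Grafting c b d' a) {d : C} {p q r : ℤ} (hr : p + q = r)
    (x : (adjoin P.toGradedOperad E).obj m c d p) (y : (adjoin P.toGradedOperad E).obj n b d' q) :
    z.derivation ((adjoin _ E).comp g hr x y) =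
      (adjoin _ E).comp g (by omega) (z.derivation x) y +
        p.negOnePow • (adjoin _ E).comp g (by omega) x (z.derivation y) := by
  refine (congrArg Prod.snd (z.dualHom.map_comp g hr x y)).trans ?_
  change (adjoin _ E).comp g _ (z.derivation x) (z.dualHom.map y).1 +
    p.negOnePow • (adjoin _ E).comp g _ (z.dualHom.map x).1 (z.derivation y) = _
  rw [dualHom_fst, dualHom_fst]

/-- The square of an odd derivation is a derivation, so it is enough that it vanish on generators:
on `P` by `∂² = 0`, on cells because they are attached along cycles. For composites the two terms
`∂x ∘ ∂y` carry the opposite signs `(-1)^(p-1)` and `(-1)^p`. -/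
theorem derivation_derivation {n : ℕ} {c : Fin (n + 1) → C} {d : C} {p : ℤ}
    (x : (adjoin P.toGradedOperad E).obj n c d p) : z.derivation (z.derivation x) = 0 := by
  induction x using adjoin_induction with
  | base x => rw [derivation_base, derivation_base, P.diff_diff, map_zero]
  | cell x => rw [derivation_cell, derivation_base, z.diff_map, map_zero]
  | add x y hx hy => rw [map_add, map_add, hx, hy, add_zero]
  | smul r x hx => rw [map_smul, map_smul, hx, smul_zero]
  | act σ h x hx => rw [derivation_act, derivation_act, hx, map_zero]
  | @comp m n N c b d' a g d p q r hr x y hx hy =>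
    have e : (p - 1).negOnePow = -p.negOnePow := by rw [Int.negOnePow_sub]; simp
    rw [derivation_comp, map_add, LinearMap.map_intUnits_smul, derivation_comp, derivation_comp,
      hx, hy, map_zero, map_zero, LinearMap.zero_apply, e, zero_add, smul_zero, add_zero,
      Units.neg_smul, neg_add_cancel]

/-- The result `(P * Γ(E), ∂)` of attaching cells to `P`. -/
def attach : DGOperad.{u, v, w} k C where
  toGradedOperad := adjoin P.toGradedOperad E
  -- The transport becomes the identity definitionally once the target degree is replaced by `p -
  -- 1`, which is how each axiom below begins.
  diff h := (adjoin P.toGradedOperad E).degCast (by omega) ∘ₗ z.derivation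
  diff_diff {n c d p p' p''} h h' x := by
    obtain rfl : p' = p - 1 := by omega
    obtain rfl : p'' = p - 1 - 1 := by omega
    exact z.derivation_derivation x
  diff_act {n} σ {c c' d p p'} h hσ x := by
    obtain rfl : p' = p - 1 := by omega
    exact z.derivation_act σ hσ x
  diff_one {p'} h d := by
    obtain rfl : p' = 0 - 1 := by omega
    exact congrArg Prod.snd (z.dualHom.map_one d)
  diff_comp {m n N c b d' a} g {d p q r p' q' r'} hp hq hr h h₁ h₂ x y := by
    obtain rfl : p' = p - 1 := by omega
    obtain rfl : q' = q - 1 := by omega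
    obtain rfl : r' = r - 1 := by omega
    exact z.derivation_comp g h x y

/-- The inclusion of `P` into the result of attaching cells. -/
def attachBase : Hom P z.attach where
  toGradedHom := adjoinBase P.toGradedOperad E
  map_diff {n c d p p'} h x := by
    obtain rfl : p' = p - 1 := by omega
    rfl

/-- The inclusion of the cells. -/
def attachCell : ColoredCollection.Hom E z.attach.toColoredCollection :=
  adjoinCell P.toGradedOperad E

/-- The map out of `(P * Γ(E), ∂)` given by its values on `P` and `E`. -/
def attachLift {Q : DGOperad.{u, v, w} k C} (α : Hom P Q)
    (t : ColoredCollection.Hom E Q.toColoredCollection)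
    (ht : ∀ {n : ℕ} {c : Fin (n + 1) → C} {d : C} {p : ℤ} (x : E.obj n c d p),
      α.map (z.map x) = Q.diff (sub_add_cancel p 1) (t.map x)) : Hom z.attach Q where
  toGradedHom := adjoinLift α.toGradedHom t
  map_diff {n c d p p'} h x := by
    obtain rfl : p' = p - 1 := by omega
    change (adjoinLift α.toGradedHom t).map (z.derivation x) =
      Q.diff (sub_add_cancel p 1) ((adjoinLift α.toGradedHom t).map x)
    set φ := adjoinLift (E := E) α.toGradedHom t
    clear h
    induction x using adjoin_induction with
    | base x => exact α.map_diff _ x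
    | cell x => exact ht x
    | add x y hx hy => rw [map_add, map_add, map_add, map_add, hx, hy]
    | smul r x hx => rw [map_smul, map_smul, map_smul, map_smul, hx]
    | act σ h x hx => rw [derivation_act, φ.map_act, φ.map_act, hx, Q.diff_act]
    | @comp m n N c b d' a g d p q r hr x y hx hy =>
      rw [derivation_comp, map_add, LinearMap.map_intUnits_smul, φ.map_comp, φ.map_comp,
        φ.map_comp, hx, hy, Q.diff_comp g (sub_add_cancel p 1) (sub_add_cancel q 1)]

end AttachingMap

end DGOperad

/-! ### Quotients by differential ideals. -/

namespace DGOperad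

variable {k : Type u} [CommRing k] {C : Type v}

/-- A differential ideal of an operad. -/
structure DiffIdeal (P : DGOperad.{u, v, w} k C) where
  carrier : ∀ (n : ℕ) (c : Fin (n + 1) → C) (d : C) (p : ℤ), Submodule k (P.obj n c d p)
  act_mem : ∀ {n : ℕ} (σ : Equiv.Perm (Fin (n + 1))) {c c' : Fin (n + 1) → C} {d : C} {p : ℤ}
    (h : ∀ j, c' j = c (σ j)) (x : P.obj n c d p), x ∈ carrier n c d p →
      P.act σ h x ∈ carrier n c' d p
  comp_left_mem : ∀ {m n N : ℕ} {c : Fin (m + 1) → C} {b : Fin (n + 1) → C} {d' : C}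
    {a : Fin (N + 1) → C} (g : Grafting c b d' a) {d : C} {p q r : ℤ} (hr : p + q = r)
    (x : P.obj m c d p) (y : P.obj n b d' q), x ∈ carrier m c d p →
      P.comp g hr x y ∈ carrier N a d r
  comp_right_mem : ∀ {m n N : ℕ} {c : Fin (m + 1) → C} {b : Fin (n + 1) → C} {d' : C}
    {a : Fin (N + 1) → C} (g : Grafting c b d' a) {d : C} {p q r : ℤ} (hr : p + q = r)
    (x : P.obj m c d p) (y : P.obj n b d' q), y ∈ carrier n b d' q →
      P.comp g hr x y ∈ carrier N a d r
  diff_mem : ∀ {n : ℕ} {c : Fin (n + 1) → C} {d : C} {p p' : ℤ} (h : p' + 1 = p)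
    (x : P.obj n c d p), x ∈ carrier n c d p → P.diff h x ∈ carrier n c d p'

namespace DiffIdeal

variable {P : DGOperad.{u, v, w} k C} (I : DiffIdeal P)

/-- The partial compositions of the quotient by a differential ideal. -/
def quotientComp {m n N : ℕ} {c : Fin (m + 1) → C} {b : Fin (n + 1) → C} {d' : C}
    {a : Fin (N + 1) → C} (g : Grafting c b d' a) {d : C} {p q r : ℤ} (hr : p + q = r) :
    (P.obj m c d p ⧸ I.carrier m c d p) →ₗ[k] (P.obj n b d' q ⧸ I.carrier n b d' q) →ₗ[k]
      (P.obj N a d r ⧸ I.carrier N a d r) :=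
  Submodule.liftQ _
    { toFun := fun x => Submodule.mapQ _ _ (P.comp g hr x) fun y hy => I.comp_right_mem g hr x y hy
      map_add' := fun x x' => by
        ext y
        simp
      map_smul' := fun r x => by
        ext y
        simp } <| by
    intro x hx
    refine Submodule.linearMap_qext _ (LinearMap.ext fun y => ?_)
    exact (Submodule.Quotient.mk_eq_zero _).2 (I.comp_left_mem g hr x y hx)

/-- The quotient of an operad by a differential ideal. -/
def quotient : DGOperad.{u, v, w} k C where
  obj n c d p := P.obj n c d p ⧸ I.carrier n c d p
  act σ _ _ _ _ h := Submodule.mapQ _ _ (P.act σ h) fun x hx => I.act_mem σ h x hx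
  act_one h x := by
    induction x using Submodule.Quotient.induction_on with | _ x
    exact congrArg _ (P.act_one h x)
  act_mul σ τ _ _ _ _ _ h h' h'' x := by
    induction x using Submodule.Quotient.induction_on with | _ x
    exact congrArg _ (P.act_mul σ τ h h' h'' x)
  one d := Submodule.Quotient.mk (P.one d)
  comp g _ _ _ _ hr := I.quotientComp g hr
  act_comp g g' σ hσ h₁ h₂ h₃ d p q r hr x y := by
    induction x using Submodule.Quotient.induction_on with | _ x
    induction y using Submodule.Quotient.induction_on with | _ y
    exact congrArg _ (P.act_comp g g' σ hσ h₁ h₂ h₃ hr x y)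
  comp_act g g' σ hσ τ hτ h₁ h₂ h₃ d p q r hr x y := by
    induction x using Submodule.Quotient.induction_on with | _ x
    induction y using Submodule.Quotient.induction_on with | _ y
    exact congrArg _ (P.comp_act g g' σ hσ τ hτ h₁ h₂ h₃ hr x y)
  comp_sequential g g' h h' H d p q r pq qr pqr hpq hqr h₁ h₂ x y z := by
    induction x using Submodule.Quotient.induction_on with | _ x
    induction y using Submodule.Quotient.induction_on with | _ y
    induction z using Submodule.Quotient.induction_on with | _ z
    exact congrArg _ (P.comp_sequential g g' h h' H hpq hqr h₁ h₂ x y z)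
  comp_parallel g g' h h' H d p q r pq pr pqr hpq hpr h₁ h₂ x y z := by
    induction x using Submodule.Quotient.induction_on with | _ x
    induction y using Submodule.Quotient.induction_on with | _ y
    induction z using Submodule.Quotient.induction_on with | _ z
    exact (congrArg _ (P.comp_parallel g g' h h' H hpq hpr h₁ h₂ x y z)).trans
      ((Submodule.mkQ _).map_intUnits_smul _ _)
  comp_one g h₁ h₂ d p hr x := by
    induction x using Submodule.Quotient.induction_on with | _ x
    exact congrArg _ (P.comp_one g h₁ h₂ hr x)
  one_comp g h₁ q hr y := by
    induction y using Submodule.Quotient.induction_on with | _ y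
    exact congrArg _ (P.one_comp g h₁ hr y)
  diff h := Submodule.mapQ _ _ (P.diff h) fun x hx => I.diff_mem h x hx
  diff_diff h h' x := by
    induction x using Submodule.Quotient.induction_on with | _ x
    exact congrArg _ (P.diff_diff h h' x)
  diff_act σ _ _ _ _ _ h hσ x := by
    induction x using Submodule.Quotient.induction_on with | _ x
    exact congrArg _ (P.diff_act σ h hσ x)
  diff_one h d := congrArg _ (P.diff_one h d)
  diff_comp g d p q r p' q' r' hp hq hr h h₁ h₂ x y := by
    induction x using Submodule.Quotient.induction_on with | _ x
    induction y using Submodule.Quotient.induction_on with | _ y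
    refine (congrArg (Submodule.mkQ _) (P.diff_comp g hp hq hr h h₁ h₂ x y)).trans ?_
    rw [map_add, LinearMap.map_intUnits_smul]
    rfl

end DiffIdeal

/-! ### Colimits of sequences of operads. -/

section Colimit

open Filter

variable (R : ℕ → DGOperad.{u, v, w} k C) (i : ∀ s, Hom (R s) (R (s + 1)))

/-- Sequences of elements that are eventually compatible with the maps `i`. -/
def coherentObj (n : ℕ) (c : Fin (n + 1) → C) (d : C) (p : ℤ) :
    Submodule k (∀ s, (R s).obj n c d p) where
  carrier := {x | ∀ᶠ s in atTop, (i s).map (x s) = x (s + 1)}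
  zero_mem' := .of_forall fun s => map_zero _
  add_mem' {x y} hx hy := by
    filter_upwards [hx, hy] with s hx hy
    simp [hx, hy]
  smul_mem' r x hx := by
    filter_upwards [hx] with s hx
    simp [hx]

/-- The operad of sequences that are eventually compatible with the maps `i`. -/
def coherent : DGOperad.{u, v, w} k C where
  obj n c d p := coherentObj R i n c d p
  act σ _ _ _ _ h :=
    { toFun := fun x => ⟨fun s => (R s).act σ h (x.1 s), by
        filter_upwards [x.2] with s hs
        rw [(i s).map_act, hs]⟩
      map_add' := fun x y => Subtype.ext (funext fun s => map_add _ _ _)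
      map_smul' := fun r x => Subtype.ext (funext fun s => map_smul _ _ _) }
  act_one h x := Subtype.ext (funext fun s => (R s).act_one h _)
  act_mul σ τ _ _ _ _ _ h h' h'' x :=
    Subtype.ext (funext fun s => (R s).act_mul σ τ h h' h'' _)
  one d := ⟨fun s => (R s).one d, .of_forall fun s => (i s).map_one d⟩
  comp g _ _ _ _ hr := LinearMap.mk₂ k
    (fun x y => ⟨fun s => (R s).comp g hr (x.1 s) (y.1 s), by
      filter_upwards [x.2, y.2] with s hx hy
      rw [(i s).map_comp, hx, hy]⟩)
    (fun _ _ _ => Subtype.ext (funext fun s => LinearMap.map_add₂ _ _ _ _))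
    (fun _ _ _ => Subtype.ext (funext fun s => LinearMap.map_smul₂ _ _ _ _))
    (fun _ _ _ => Subtype.ext (funext fun s => map_add _ _ _))
    (fun _ _ _ => Subtype.ext (funext fun s => map_smul _ _ _))
  act_comp g g' σ hσ h₁ h₂ h₃ d p q r hr x y :=
    Subtype.ext (funext fun s => (R s).act_comp g g' σ hσ h₁ h₂ h₃ hr _ _)
  comp_act g g' σ hσ τ hτ h₁ h₂ h₃ d p q r hr x y :=
    Subtype.ext (funext fun s => (R s).comp_act g g' σ hσ τ hτ h₁ h₂ h₃ hr _ _)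
  comp_sequential g g' h h' H d p q r pq qr pqr hpq hqr h₁ h₂ x y z :=
    Subtype.ext (funext fun s => (R s).comp_sequential g g' h h' H hpq hqr h₁ h₂ _ _ _)
  comp_parallel g g' h h' H d p q r pq pr pqr hpq hpr h₁ h₂ x y z :=
    Subtype.ext (funext fun s => (R s).comp_parallel g g' h h' H hpq hpr h₁ h₂ _ _ _)
  comp_one g h₁ h₂ d p hr x := Subtype.ext (funext fun s => (R s).comp_one g h₁ h₂ hr _)
  one_comp g h₁ q hr y := Subtype.ext (funext fun s => (R s).one_comp g h₁ hr _)
  diff h :=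
    { toFun := fun x => ⟨fun s => (R s).diff h (x.1 s), by
        filter_upwards [x.2] with s hs
        rw [(i s).map_diff, hs]⟩
      map_add' := fun x y => Subtype.ext (funext fun s => map_add _ _ _)
      map_smul' := fun r x => Subtype.ext (funext fun s => map_smul _ _ _) }
  diff_diff h h' x := Subtype.ext (funext fun s => (R s).diff_diff h h' _)
  diff_act σ _ _ _ _ _ h hσ x := Subtype.ext (funext fun s => (R s).diff_act σ h hσ _)
  diff_one h d := Subtype.ext (funext fun s => (R s).diff_one h d)
  diff_comp g d p q r p' q' r' hp hq hr h h₁ h₂ x y :=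
    Subtype.ext (funext fun s => (R s).diff_comp g hp hq hr h h₁ h₂ _ _)

/-- The ideal of sequences that are eventually zero. -/
def eventuallyZero : DiffIdeal (coherent R i) where
  carrier n c d p :=
    { carrier := {x : coherentObj R i n c d p | ∀ᶠ s in atTop, x.1 s = 0}
      zero_mem' := .of_forall fun s => rfl
      add_mem' := fun {x y} hx hy => by
        filter_upwards [hx, hy] with s hx hy
        exact (congrArg₂ (· + ·) hx hy).trans (add_zero 0)
      smul_mem' := fun r x hx => by
        filter_upwards [hx] with s hx
        exact (congrArg (r • ·) hx).trans (smul_zero r) }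
  act_mem σ _ _ _ _ h x hx := by
    filter_upwards [hx] with s hx
    exact (congrArg ((R s).act σ h) hx).trans (map_zero _)
  comp_left_mem g _ _ _ _ hr x y hx := by
    filter_upwards [hx] with s hx
    exact (congrArg (fun x => (R s).comp g hr x (y.1 s)) hx).trans (LinearMap.map_zero₂ _ _)
  comp_right_mem g _ _ _ _ hr x y hy := by
    filter_upwards [hy] with s hy
    exact (congrArg ((R s).comp g hr (x.1 s)) hy).trans (map_zero _)
  diff_mem h x hx := by
    filter_upwards [hx] with s hx
    exact (congrArg ((R s).diff h) hx).trans (map_zero _)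

/-- The colimit of a sequence of operads. -/
def colimit : DGOperad.{u, v, w} k C :=
  (eventuallyZero R i).quotient

variable {R i}

/-- The class in the colimit of a sequence. -/
def colimitMk {n : ℕ} {c : Fin (n + 1) → C} {d : C} {p : ℤ} :
    coherentObj R i n c d p →ₗ[k] (colimit R i).obj n c d p :=
  Submodule.mkQ ((eventuallyZero R i).carrier n c d p)

theorem colimitMk_surjective {n : ℕ} {c : Fin (n + 1) → C} {d : C} {p : ℤ}
    (x : (colimit R i).obj n c d p) : ∃ y, colimitMk y = x :=
  Submodule.mkQ_surjective _ x

/-- Only the tails of representatives matter, so identities in the colimit may be checked at all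
sufficiently late stages. -/
theorem colimitMk_eq_iff {n : ℕ} {c : Fin (n + 1) → C} {d : C} {p : ℤ}
    {x y : coherentObj R i n c d p} :
    colimitMk x = colimitMk y ↔ ∀ᶠ s in atTop, x.1 s = y.1 s := by
  refine (Submodule.Quotient.eq _).trans ?_
  refine eventually_congr (.of_forall fun s => ?_)
  exact sub_eq_zero (a := x.1 s) (b := y.1 s)

variable (R i) in
/-- The transition maps of a sequence of operads. -/
def trans (s : ℕ) {t : ℕ} (h : s ≤ t) :
    GradedOperad.Hom (R s).toGradedOperad (R t).toGradedOperad :=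
  Nat.leRec (motive := fun t _ => GradedOperad.Hom (R s).toGradedOperad (R t).toGradedOperad)
    (.id _) (fun t _ f => (i t).toGradedHom.comp f) h

theorem trans_self (s : ℕ) : trans R i s le_rfl = .id _ :=
  Nat.leRec_self ..

theorem trans_succ {s t : ℕ} (h : s ≤ t) :
    trans R i s (h.trans (Nat.le_succ t)) = (i t).toGradedHom.comp (trans R i s h) :=
  Nat.leRec_succ ..

theorem trans_diff {s t : ℕ} (h : s ≤ t) {n : ℕ} {c : Fin (n + 1) → C} {d : C} {p p' : ℤ}
    (hp : p' + 1 = p) (x : (R s).obj n c d p) :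
    (trans R i s h).map ((R s).diff hp x) = (R t).diff hp ((trans R i s h).map x) := by
  induction t, h using Nat.le_induction with
  | base => rw [trans_self]; rfl
  | succ t h ih =>
    rw [trans_succ]
    exact (congrArg (i t).map ih).trans ((i t).map_diff hp _)

open Classical in
/-- The sequence that starts with a given element at stage `s`. -/
noncomputable def thread (s : ℕ) {n : ℕ} {c : Fin (n + 1) → C} {d : C} {p : ℤ} :
    (R s).obj n c d p →ₗ[k] coherentObj R i n c d p :=
  LinearMap.codRestrict _
    -- The value `0` before stage `s` is arbitrary: coherence is required only eventually, and the
    -- class in the colimit ignores initial terms.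
    (LinearMap.pi fun t => if h : s ≤ t then (trans R i s h).map else 0) fun x => by
      filter_upwards [eventually_ge_atTop s] with t ht
      rw [LinearMap.pi_apply, LinearMap.pi_apply, dif_pos ht, dif_pos (ht.trans (Nat.le_succ t)),
        trans_succ ht]
      rfl

theorem thread_apply {s t : ℕ} (h : s ≤ t) {n : ℕ} {c : Fin (n + 1) → C} {d : C} {p : ℤ}
    (x : (R s).obj n c d p) : (thread (i := i) s x).1 t = (trans R i s h).map x := by
  change (if h : s ≤ t then (trans R i s h).map else 0) x = _
  rw [dif_pos h]

variable (R i) in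
/-- The map from a stage to the colimit. -/
noncomputable def ofStage (s : ℕ) : Hom (R s) (colimit R i) where
  map := colimitMk ∘ₗ thread s
  map_act σ _ _ _ _ h x := colimitMk_eq_iff.2 <| by
    filter_upwards [eventually_ge_atTop s] with t ht
    exact (thread_apply ht _).trans <| ((trans R i s ht).map_act σ h x).trans
      (congrArg _ (thread_apply ht _).symm)
  map_one d := colimitMk_eq_iff.2 <| by
    filter_upwards [eventually_ge_atTop s] with t ht
    exact (thread_apply ht _).trans ((trans R i s ht).map_one d)
  map_comp g _ _ _ _ hr x y := colimitMk_eq_iff.2 <| by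
    filter_upwards [eventually_ge_atTop s] with t ht
    exact (thread_apply ht _).trans <| ((trans R i s ht).map_comp g hr x y).trans
      (congrArg₂ (fun x y => (R t).comp g hr x y) (thread_apply ht _).symm (thread_apply ht _).symm)
  map_diff h x := colimitMk_eq_iff.2 <| by
    filter_upwards [eventually_ge_atTop s] with t ht
    exact (thread_apply ht _).trans <| (trans_diff ht h x).trans
      (congrArg _ (thread_apply ht _).symm)

theorem ofStage_eq_colimitMk {s : ℕ} {n : ℕ} {c : Fin (n + 1) → C} {d : C} {p : ℤ}
    (y : coherentObj R i n c d p) (hy : ∀ t, s ≤ t → (i t).map (y.1 t) = y.1 (t + 1)) :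
    (ofStage R i s).map (y.1 s) = colimitMk y := by
  refine colimitMk_eq_iff.2 ?_
  filter_upwards [eventually_ge_atTop s] with t ht
  rw [thread_apply ht]
  induction t, ht using Nat.le_induction with
  | base => rw [trans_self]; rfl
  | succ t ht ih =>
    rw [trans_succ]
    exact (congrArg (i t).map ih).trans (hy t ht)

theorem ofStage_succ (s : ℕ) {n : ℕ} {c : Fin (n + 1) → C} {d : C} {p : ℤ}
    (x : (R s).obj n c d p) :
    (ofStage R i (s + 1)).map ((i s).map x) = (ofStage R i s).map x := by
  refine colimitMk_eq_iff.2 ?_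
  filter_upwards [eventually_ge_atTop (s + 1)] with t ht
  rw [thread_apply ht, thread_apply ((Nat.le_succ s).trans ht)]
  induction t, ht using Nat.le_induction with
  | base => rw [trans_self, trans_succ le_rfl, trans_self]; rfl
  | succ t ht ih =>
    rw [trans_succ ht, trans_succ ((Nat.le_succ s).trans ht)]
    exact congrArg (i t).map ih

theorem exists_ofStage_eq {n : ℕ} {c : Fin (n + 1) → C} {d : C} {p : ℤ}
    (x : (colimit R i).obj n c d p) : ∃ (s : ℕ) (y : (R s).obj n c d p),
      (ofStage R i s).map y = x := by
  obtain ⟨y, rfl⟩ := colimitMk_surjective x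
  obtain ⟨s, hs⟩ := eventually_atTop.1 y.2
  exact ⟨s, y.1 s, ofStage_eq_colimitMk y hs⟩

/-- A vanishing boundary in the colimit vanishes from some stage on; moving there, the
representative is itself a cycle, along which a cell can be attached. -/
theorem exists_cycle_ofStage_eq {n : ℕ} {c : Fin (n + 1) → C} {d : C} {p p' : ℤ}
    (h : p' + 1 = p) (x : (colimit R i).obj n c d p) (hx : (colimit R i).diff h x = 0) :
    ∃ (s : ℕ) (y : (R s).obj n c d p), (R s).diff h y = 0 ∧ (ofStage R i s).map y = x := by
  obtain ⟨y, rfl⟩ := colimitMk_surjective x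
  have h0 : ∀ᶠ s in atTop, (R s).diff h (y.1 s) = 0 :=
    colimitMk_eq_iff.1 (hx.trans (map_zero colimitMk).symm)
  obtain ⟨s, hs⟩ := eventually_atTop.1 (h0.and y.2)
  exact ⟨s, y.1 s, (hs s le_rfl).1, ofStage_eq_colimitMk y fun t ht => (hs t ht).2⟩

theorem colimit_hom_ext {T : GradedOperad.{u, v, w} k C}
    {φ ψ : GradedOperad.Hom (colimit R i).toGradedOperad T}
    (h : ∀ (s : ℕ) {n : ℕ} {c : Fin (n + 1) → C} {d : C} {p : ℤ} (x : (R s).obj n c d p),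
      φ.map ((ofStage R i s).map x) = ψ.map ((ofStage R i s).map x)) : φ = ψ := by
  refine GradedOperad.Hom.ext' fun x => ?_
  obtain ⟨s, y, rfl⟩ := exists_ofStage_eq x
  exact h s y

section Lift

variable {T : GradedOperad.{u, v, w} k C}
  (φ : ∀ s, GradedOperad.Hom (R s).toGradedOperad T)

/-- Once the sequence is coherent, compatibility of the `φ s` makes its images constant; this
constant is the value of the induced morphism. -/
theorem exists_eventually_map_eq
    (hφ : ∀ (s : ℕ) {n : ℕ} {c : Fin (n + 1) → C} {d : C} {p : ℤ} (x : (R s).obj n c d p),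
      (φ (s + 1)).map ((i s).map x) = (φ s).map x)
    {n : ℕ} {c : Fin (n + 1) → C} {d : C} {p : ℤ}
    (x : coherentObj R i n c d p) :
    ∃ v : T.obj n c d p, ∀ᶠ s in atTop, (φ s).map (x.1 s) = v := by
  obtain ⟨s, hs⟩ := eventually_atTop.1 x.2
  refine ⟨(φ s).map (x.1 s), ?_⟩
  filter_upwards [eventually_ge_atTop s] with t ht
  induction t, ht using Nat.le_induction with
  | base => rfl
  | succ t ht ih => rw [← hs t ht, hφ, ih]

variable (hφ : ∀ (s : ℕ) {n : ℕ} {c : Fin (n + 1) → C} {d : C} {p : ℤ} (x : (R s).obj n c d p),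
    (φ (s + 1)).map ((i s).map x) = (φ s).map x)

/-- The eventual value of a compatible family of morphisms on a sequence. -/
noncomputable def eventualValue {n : ℕ} {c : Fin (n + 1) → C} {d : C} {p : ℤ}
    (x : coherentObj R i n c d p) : T.obj n c d p :=
  (exists_eventually_map_eq φ hφ x).choose

theorem eventually_eq_eventualValue {n : ℕ} {c : Fin (n + 1) → C} {d : C} {p : ℤ}
    (x : coherentObj R i n c d p) : ∀ᶠ s in atTop, (φ s).map (x.1 s) = eventualValue φ hφ x :=
  (exists_eventually_map_eq φ hφ x).choose_spec

theorem eventualValue_eq {n : ℕ} {c : Fin (n + 1) → C} {d : C} {p : ℤ}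
    {x : coherentObj R i n c d p} {y : T.obj n c d p}
    (h : ∀ᶠ s in atTop, (φ s).map (x.1 s) = y) : eventualValue φ hφ x = y := by
  obtain ⟨s, hs, hs'⟩ := ((eventually_eq_eventualValue φ hφ x).and h).exists
  exact hs.symm.trans hs'

/-- The morphism out of a colimit given by its values on the stages. -/
noncomputable def colimitLift : GradedOperad.Hom (colimit R i).toGradedOperad T where
  map {n c d p} := Submodule.liftQ ((eventuallyZero R i).carrier n c d p)
    ({ toFun := eventualValue φ hφ
       map_add' := fun x y => eventualValue_eq φ hφ <| by
        filter_upwards [eventually_eq_eventualValue φ hφ x, eventually_eq_eventualValue φ hφ y]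
          with s hx hy
        rw [← hx, ← hy]
        exact map_add _ _ _
       map_smul' := fun r x => eventualValue_eq φ hφ <| by
        filter_upwards [eventually_eq_eventualValue φ hφ x] with s hx
        rw [← hx]
        exact map_smul _ _ _ } : coherentObj R i n c d p →ₗ[k] T.obj n c d p) <| by
    intro x hx
    refine eventualValue_eq φ hφ ?_
    filter_upwards [hx] with s hx
    rw [hx, map_zero]
  map_act σ c c' d p h x := by
    obtain ⟨x, rfl⟩ := colimitMk_surjective x
    refine eventualValue_eq φ hφ ?_
    filter_upwards [eventually_eq_eventualValue φ hφ x] with s hx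
    exact ((φ s).map_act σ h _).trans (congrArg _ hx)
  map_one d := eventualValue_eq φ hφ (.of_forall fun s => (φ s).map_one d)
  map_comp g _ _ _ _ hr x y := by
    obtain ⟨x, rfl⟩ := colimitMk_surjective x
    obtain ⟨y, rfl⟩ := colimitMk_surjective y
    refine eventualValue_eq φ hφ ?_
    filter_upwards [eventually_eq_eventualValue φ hφ x, eventually_eq_eventualValue φ hφ y]
      with s hx hy
    exact ((φ s).map_comp g hr _ _).trans (congrArg₂ (fun x y => T.comp g hr x y) hx hy)

theorem colimitLift_ofStage (s : ℕ) {n : ℕ} {c : Fin (n + 1) → C} {d : C} {p : ℤ}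
    (x : (R s).obj n c d p) :
    (colimitLift φ hφ).map ((ofStage R i s).map x) = (φ s).map x := by
  refine eventualValue_eq φ hφ ?_
  filter_upwards [eventually_ge_atTop s] with t ht
  rw [thread_apply ht]
  induction t, ht using Nat.le_induction with
  | base => rw [trans_self]; rfl
  | succ t ht ih =>
    rw [trans_succ ht]
    exact (hφ t _).trans ih

end Lift

end Colimit

end DGOperad

variable {k : Type u} [CommRing k] {C : Type v}

/-! ### Initiality of the trivial operad, free operads and direct sums. -/

namespace GradedOperad

/-- A graded operad, as a differential operad with zero differential. -/
def withZeroDiff (T : GradedOperad.{u, v, w} k C) : DGOperad.{u, v, w} k C where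
  toGradedOperad := T
  diff _ := 0
  diff_diff _ _ _ := rfl
  diff_act _ _ _ _ _ _ _ hσ _ := (map_zero (T.act _ hσ)).symm
  diff_one _ _ := rfl
  diff_comp _ _ _ _ _ _ _ _ _ _ _ _ _ _ _ _ := by simp

/-- Each nonzero component is spanned by a unit, and morphisms preserve units. -/
theorem trivialOperad_hom_ext {T : GradedOperad.{u, v, w} k C}
    (φ ψ : Hom (DGOperad.trivialOperad.{u, v, w} k C).toGradedOperad T) : φ = ψ := by
  refine Hom.ext' fun {n c d p} x => ?_
  by_cases H : DGOperad.IsUnitIndex n c d p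
  · obtain ⟨rfl, hc, rfl⟩ := H
    obtain rfl : c = fun _ => d := funext fun j => by rw [DGOperad.fin_one_eq j 0, hc]
    have hx : x = x.1.down • (DGOperad.trivialOperad.{u, v, w} k C).one d :=
      Subtype.ext (ULift.ext _ _ (mul_one _).symm)
    rw [hx, map_smul, map_smul, φ.map_one, ψ.map_one]
  · have hx : x = 0 := Subtype.ext (x.2 H)
    rw [hx, map_zero, map_zero]

/-- The free operad on a collection. -/
def free (E : ColoredCollection.{u, v, w} k C) : GradedOperad.{u, v, w} k C :=
  adjoin (DGOperad.trivialOperad.{u, v, w} k C).toGradedOperad E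

/-- The inclusion of the generators into a free operad. -/
def freeIncl (E : ColoredCollection.{u, v, w} k C) :
    ColoredCollection.Hom E (free E).toColoredCollection :=
  adjoinCell _ E

/-- The morphism out of a free operad given by its values on the generators. -/
noncomputable def freeLift {E : ColoredCollection.{u, v, w} k C} {T : GradedOperad.{u, v, w} k C}
    (t : ColoredCollection.Hom E T.toColoredCollection) : Hom (free E) T :=
  -- The unit map is available for differential operads only, hence the zero differential on `T`.
  adjoinLift T.withZeroDiff.unitMap.toGradedHom t

theorem freeLift_incl {E : ColoredCollection.{u, v, w} k C} {T : GradedOperad.{u, v, w} k C}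
    (t : ColoredCollection.Hom E T.toColoredCollection) {n : ℕ} {c : Fin (n + 1) → C} {d : C}
    {p : ℤ} (x : E.obj n c d p) : (freeLift t).map ((freeIncl E).map x) = t.map x :=
  rfl

theorem free_hom_ext {E : ColoredCollection.{u, v, w} k C} {T : GradedOperad.{u, v, w} k C}
    {φ ψ : Hom (free E) T}
    (h : ∀ {n : ℕ} {c : Fin (n + 1) → C} {d : C} {p : ℤ} (x : E.obj n c d p),
      φ.map ((freeIncl E).map x) = ψ.map ((freeIncl E).map x)) : φ = ψ :=
  adjoin_hom_ext (fun x => congrArg (fun χ : Hom _ T => χ.map x)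
    (trivialOperad_hom_ext (φ.comp (adjoinBase _ E)) (ψ.comp (adjoinBase _ E)))) h

theorem isFree_freeIncl (E : ColoredCollection.{u, v, w} k C) : IsFree (freeIncl E) := fun _ t =>
  ⟨freeLift t, freeLift_incl t, fun _ hφ =>
    free_hom_ext fun x => (hφ x).trans (freeLift_incl t x).symm⟩

theorem Generated.mono {P : GradedOperad.{u, v, w} k C}
    {A B : ∀ (n : ℕ) (c : Fin (n + 1) → C) (d : C) (p : ℤ), Set (P.obj n c d p)}
    (h : ∀ n c d p, A n c d p ⊆ B n c d p) {n : ℕ} {c : Fin (n + 1) → C} {d : C} {p : ℤ}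
    {x : P.obj n c d p} (hx : P.Generated A x) : P.Generated B x := by
  induction hx with
  | of x hx => exact .of x (h _ _ _ _ hx)
  | zero => exact .zero
  | add x y _ _ hx hy => exact .add x y hx hy
  | smul r x _ hx => exact .smul r x hx
  | act σ h x _ hx => exact .act σ h x hx
  | one d => exact .one d
  | comp g hr x y _ _ hx hy => exact .comp g hr x y hx hy

end GradedOperad

namespace ColoredCollection

/-- The map out of a direct sum of collections given by its values on the summands. -/
noncomputable def directSumLift {E : ℕ → ColoredCollection.{u, v, w} k C}
    {F : ColoredCollection.{u, v, w} k C} (t : ∀ s, Hom (E s) F) : Hom (directSum E) F where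
  map := DirectSum.toModule k ℕ _ fun s => (t s).map
  map_act {n} σ {c c' d p} h x := by
    have key : DirectSum.toModule k ℕ (F.obj n c' d p) (fun s => (t s).map) ∘ₗ
          (directSum E).act σ h =
        F.act σ h ∘ₗ DirectSum.toModule k ℕ (F.obj n c d p) fun s => (t s).map := by
      refine DirectSum.linearMap_ext k fun s => LinearMap.ext fun e => ?_
      have h' := (directSumIncl E s).map_act σ h e
      change DirectSum.toModule k ℕ (F.obj n c' d p) (fun s => (t s).map)
        ((directSum E).act σ h ((directSumIncl E s).map e)) = F.act σ h
          (DirectSum.toModule k ℕ (F.obj n c d p) (fun s => (t s).map) (DirectSum.lof k ℕ _ s e))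
      rw [← h', DirectSum.toModule_lof, ← (t s).map_act]
      exact DirectSum.toModule_lof ..
    exact LinearMap.congr_fun key x

theorem directSumLift_incl {E : ℕ → ColoredCollection.{u, v, w} k C}
    {F : ColoredCollection.{u, v, w} k C} (t : ∀ s, Hom (E s) F) (s : ℕ) {n : ℕ}
    {c : Fin (n + 1) → C} {d : C} {p : ℤ} (e : (E s).obj n c d p) :
    (directSumLift t).map ((directSumIncl E s).map e) = (t s).map e :=
  DirectSum.toModule_lof ..

theorem directSum_hom_ext {E : ℕ → ColoredCollection.{u, v, w} k C} {n : ℕ}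
    {c : Fin (n + 1) → C} {d : C} {p : ℤ} {M : Type*} [AddCommGroup M] [Module k M]
    {f g : (directSum E).obj n c d p →ₗ[k] M}
    (h : ∀ s e, f ((directSumIncl E s).map e) = g ((directSumIncl E s).map e)) : f = g :=
  DirectSum.linearMap_ext k fun s => LinearMap.ext fun e => h s e

/-- The composite `g ∘ f` of maps of collections. -/
def Hom.comp {E F G : ColoredCollection.{u, v, w} k C} (g : Hom F G) (f : Hom E F) : Hom E G where
  map := g.map ∘ₗ f.map
  map_act σ _ _ _ _ h x := by simp [f.map_act, g.map_act]

end ColoredCollection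

namespace DGOperad

open GradedOperad

theorem Hom.ext_toGradedHom {P Q : DGOperad.{u, v, w} k C} {α β : Hom P Q}
    (h : α.toGradedHom = β.toGradedHom) : α = β := by
  cases α
  cases β
  congr

/-! ### The cells that kill the homological defect of a map. -/

section Cells

variable {P Q : DGOperad.{u, v, w} k C} (α : Hom P Q)

/-- The pairs of a cycle `z` of `P` and an element of `Q` with boundary `α z`. -/
def cellObj (n : ℕ) (c : Fin (n + 1) → C) (d : C) (p : ℤ) :
    Submodule k (P.obj n c d (p - 1) × Q.obj n c d p) :=
  LinearMap.ker (P.diff (sub_add_cancel (p - 1) 1) ∘ₗ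
      LinearMap.fst k (P.obj n c d (p - 1)) (Q.obj n c d p)) ⊓
    LinearMap.eqLocus (α.map ∘ₗ LinearMap.fst k (P.obj n c d (p - 1)) (Q.obj n c d p))
      (Q.diff (sub_add_cancel p 1) ∘ₗ LinearMap.snd k (P.obj n c d (p - 1)) (Q.obj n c d p))

/-- The collection of pairs of a cycle `z` of `P` and an element of `Q` with boundary `α z`. -/
def cells : ColoredCollection.{u, v, w} k C where
  obj n c d p := cellObj α n c d p
  act σ _ _ _ _ h := ((P.act σ h).prodMap (Q.act σ h)).restrict fun x hx => by exact
    ⟨(P.diff_act σ _ h x.1).trans ((congrArg _ hx.1).trans (map_zero (P.act σ h))),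
      (α.map_act σ h x.1).trans ((congrArg (Q.act σ h) hx.2).trans (Q.diff_act σ _ h x.2).symm)⟩
  act_one h x := Subtype.ext (Prod.ext (P.act_one h _) (Q.act_one h _))
  act_mul σ τ _ _ _ _ _ h h' h'' x :=
    Subtype.ext (Prod.ext (P.act_mul σ τ h h' h'' _) (Q.act_mul σ τ h h' h'' _))

/-- The attaching map of the cells: the cycle that is to be killed. -/
def cellBoundary : AttachingMap P (cells α) where
  map := LinearMap.fst k _ _ ∘ₗ Submodule.subtype _
  map_act _ _ _ _ _ _ _ := rfl
  diff_map x := x.2.1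

/-- The values of the cells in `Q`. -/
def cellValue : ColoredCollection.Hom (cells α) Q.toColoredCollection where
  map := LinearMap.snd k _ _ ∘ₗ Submodule.subtype _
  map_act _ _ _ _ _ _ _ := rfl

/-- The extension of `α` to the operad in which all the cells are attached. -/
def cellLift : Hom (cellBoundary α).attach Q :=
  (cellBoundary α).attachLift α (cellValue α) fun x => x.2.2

end Cells

/-! ### The iterated construction and its properties. -/

section Model

variable {S Q : DGOperad.{u, v, w} k C} (f : Hom S Q)

/-- The operads obtained from `S` by attaching cells repeatedly, with their maps to `Q`. -/
def stageHom : ℕ → Σ R : DGOperad.{u, v, w} k C, Hom R Q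
  | 0 => ⟨S, f⟩
  | s + 1 => ⟨(cellBoundary (stageHom s).2).attach, cellLift (stageHom s).2⟩

/-- The operad obtained from `S` by attaching cells `s` times. -/
def stage (s : ℕ) : DGOperad.{u, v, w} k C := (stageHom f s).1

/-- The map from a stage to `Q`. -/
def stageProj (s : ℕ) : Hom (stage f s) Q := (stageHom f s).2

/-- The collection of the cells attached to a stage. -/
def stageCells (s : ℕ) : ColoredCollection.{u, v, w} k C :=
  cells (stageProj f s)

/-- The attaching map of the cells attached to a stage. -/
def stageBoundary (s : ℕ) : AttachingMap (stage f s) (stageCells f s) :=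
  cellBoundary (stageProj f s)

/-- The inclusion of a stage into the next one. -/
def stageIncl (s : ℕ) : Hom (stage f s) (stage f (s + 1)) :=
  (stageBoundary f s).attachBase

theorem stageProj_incl (s : ℕ) {n : ℕ} {c : Fin (n + 1) → C} {d : C} {p : ℤ}
    (x : (stage f s).obj n c d p) :
    (stageProj f (s + 1)).map ((stageIncl f s).map x) = (stageProj f s).map x :=
  rfl

/-- The inclusion of the cells attached to a stage into the next stage. -/
def stageCell (s : ℕ) :
    ColoredCollection.Hom (stageCells f s) (stage f (s + 1)).toColoredCollection :=
  (stageBoundary f s).attachCell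

/-- The colimit of the operads obtained from `S` by attaching cells. -/
def model : DGOperad.{u, v, w} k C :=
  colimit (stage f) (stageIncl f)

/-- The inclusion of `S` into its model over `Q`. -/
noncomputable def modelIncl : Hom S (model f) :=
  ofStage (stage f) (stageIncl f) 0

/-- The projection of the model to `Q`. -/
noncomputable def modelProj : Hom (model f) Q where
  toGradedHom := colimitLift (fun s => (stageProj f s).toGradedHom) (stageProj_incl f)
  map_diff h x := by
    obtain ⟨s, y, rfl⟩ := exists_ofStage_eq x
    refine (congrArg _ ((ofStage _ _ s).map_diff h y).symm).trans ?_
    refine (colimitLift_ofStage _ (stageProj_incl f) s _).trans ?_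
    exact ((stageProj f s).map_diff h y).trans
      (congrArg (Q.diff h) (colimitLift_ofStage (fun s => (stageProj f s).toGradedHom)
        (stageProj_incl f) s y).symm)

theorem modelProj_ofStage (s : ℕ) {n : ℕ} {c : Fin (n + 1) → C} {d : C} {p : ℤ}
    (x : (stage f s).obj n c d p) :
    (modelProj f).map ((ofStage _ (stageIncl f) s).map x) = (stageProj f s).map x :=
  colimitLift_ofStage ..

theorem modelProj_comp_modelIncl : (modelProj f).comp (modelIncl f) = f :=
  Hom.ext_toGradedHom (Hom.ext' fun x => modelProj_ofStage f 0 x)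

/-- The cells of the model attached to a stage. -/
noncomputable def modelCell (s : ℕ) :
    ColoredCollection.Hom (stageCells f s) (model f).toColoredCollection :=
  (ofStage _ (stageIncl f) (s + 1)).toHom.comp (stageCell f s)

theorem diff_modelCell (s : ℕ) {n : ℕ} {c : Fin (n + 1) → C} {d : C} {p : ℤ}
    (e : (stageCells f s).obj n c d p) :
    (model f).diff (sub_add_cancel p 1) ((modelCell f s).map e) =
      (ofStage _ (stageIncl f) s).map ((stageBoundary f s).map e) :=
  ((ofStage _ (stageIncl f) (s + 1)).map_diff _ _).symm.trans (ofStage_succ s _)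

theorem modelProj_modelCell (s : ℕ) {n : ℕ} {c : Fin (n + 1) → C} {d : C} {p : ℤ}
    (e : (stageCells f s).obj n c d p) :
    (modelProj f).map ((modelCell f s).map e) = (cellValue (stageProj f s)).map e :=
  modelProj_ofStage ..

/-- The hypotheses say exactly that `(y, q)` is a cell attached to stage `s`, and its boundary is
`y`. -/
theorem exists_diff_eq_ofStage {s : ℕ} {n : ℕ} {c : Fin (n + 1) → C} {d : C} {p p' : ℤ}
    (h : p' + 1 = p) (y : (stage f s).obj n c d p')
    (hy : (stage f s).diff (sub_add_cancel p' 1) y = 0) (q : Q.obj n c d p)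
    (hq : (stageProj f s).map y = Q.diff h q) :
    ∃ x, (model f).diff h x = (ofStage _ (stageIncl f) s).map y := by
  obtain rfl : p' = p - 1 := by omega
  exact ⟨_, diff_modelCell f s ⟨(y, q), hy, hq⟩⟩

theorem isHomologyIso_modelProj : (modelProj f).IsHomologyIso := by
  intro n c d p
  constructor
  · rw [injective_iff_map_eq_zero]
    intro x hx
    induction x using Submodule.Quotient.induction_on with | _ x
    obtain ⟨q, hq⟩ := (Submodule.Quotient.mk_eq_zero _).1 hx
    obtain ⟨s, y, hy, hyx⟩ := exists_cycle_ofStage_eq _ x.1 x.2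
    obtain ⟨w, hw⟩ := exists_diff_eq_ofStage f rfl y hy q <|
      (modelProj_ofStage f s y).symm.trans ((congrArg (modelProj f).map hyx).trans hq.symm)
    exact (Submodule.Quotient.mk_eq_zero _).2 ⟨w, hw.trans hyx⟩
  · intro y
    induction y using Submodule.Quotient.induction_on with | _ y
    -- A cell with zero attaching cycle is itself a cycle of the model; its image is the prescribed
    -- cycle of `Q`, so surjectivity needs only the first step.
    let e : (stageCells f 0).obj n c d p :=
      ⟨(0, y.1), map_zero ((stage f 0).diff (sub_add_cancel (p - 1) 1)),
        (map_zero (stageProj f 0).map).trans y.2.symm⟩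
    refine ⟨Submodule.Quotient.mk ⟨(modelCell f 0).map e, ?_⟩, ?_⟩
    · exact (diff_modelCell f 0 e).trans (map_zero _)
    · exact congrArg _ (Subtype.ext (modelProj_modelCell f 0 e))

/-- The free operad on all the cells, mapped to the model. -/
noncomputable def modelFree :
    GradedOperad.Hom (free (ColoredCollection.directSum (stageCells f))) (model f).toGradedOperad :=
  freeLift (ColoredCollection.directSumLift (modelCell f))

theorem modelFree_cell (s : ℕ) {n : ℕ} {c : Fin (n + 1) → C} {d : C} {p : ℤ}
    (e : (stageCells f s).obj n c d p) :
    (modelFree f).map ((freeIncl _).map ((ColoredCollection.directSumIncl _ s).map e)) =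
      (modelCell f s).map e :=
  (freeLift_incl _ _).trans (ColoredCollection.directSumLift_incl ..)

/-- The morphisms from the stages given by their values on `S` and the cells. -/
def stageLift {T : GradedOperad.{u, v, w} k C} (σ : GradedOperad.Hom S.toGradedOperad T)
    (t : ∀ s, ColoredCollection.Hom (stageCells f s) T.toColoredCollection) :
    ∀ s, GradedOperad.Hom (stage f s).toGradedOperad T
  | 0 => σ
  | s + 1 => adjoinLift (stageLift σ t s) (t s)

theorem isCoproduct_model : IsCoproduct (modelIncl f).toGradedHom (modelFree f) := by
  intro T σ t
  let τ (s : ℕ) := (t.toHom.comp (freeIncl _)).comp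
    (ColoredCollection.directSumIncl (stageCells f) s)
  let φ : GradedOperad.Hom (model f).toGradedOperad T :=
    -- Compatibility is definitional: each morphism restricts to the previous one on the base of the
    -- adjunction.
    colimitLift (stageLift f σ τ) fun _ _ _ _ _ _ => rfl
  have hφ (s : ℕ) {n : ℕ} {c : Fin (n + 1) → C} {d : C} {p : ℤ} (x : (stage f s).obj n c d p) :
      φ.map ((ofStage _ (stageIncl f) s).map x) = (stageLift f σ τ s).map x :=
    colimitLift_ofStage ..
  refine ⟨φ, ⟨fun x => hφ 0 x, fun x => ?_⟩, fun ψ ⟨hψ, hψ'⟩ => colimit_hom_ext fun s => ?_⟩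
  · have key : φ.comp (modelFree f) = t := free_hom_ext fun {n c d p} x => by
      refine LinearMap.congr_fun (f := φ.map ∘ₗ (modelFree f).map ∘ₗ (freeIncl _).map)
        (g := t.map ∘ₗ (freeIncl _).map) (ColoredCollection.directSum_hom_ext fun s e => ?_) x
      exact (congrArg φ.map (modelFree_cell f s e)).trans (hφ (s + 1) _)
    exact congrArg (fun χ : GradedOperad.Hom _ T => χ.map x) key
  -- Uniqueness is proved by induction on stages: a morphism on stage `s + 1` is fixed by its
  -- restriction to stage `s` and by the cells, whose images are the generators of the free factor.
  · have key : ψ.comp (ofStage _ (stageIncl f) s).toGradedHom =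
        φ.comp (ofStage _ (stageIncl f) s).toGradedHom := by
      induction s with
      | zero => exact Hom.ext' fun x => (hψ x).trans (hφ 0 x).symm
      | succ s ih =>
        refine adjoin_hom_ext (fun x => ?_) fun e => ?_
        · refine (congrArg ψ.map (ofStage_succ s x)).trans (Eq.trans ?_
            (congrArg φ.map (ofStage_succ s x)).symm)
          exact congrArg (fun χ : GradedOperad.Hom _ T => χ.map x) ih
        · refine Eq.trans ?_ (hφ (s + 1) ((stageCell f s).map e)).symm
          exact (congrArg ψ.map (modelFree_cell f s e).symm).trans (hψ' _)
    exact fun {_ _ _ _} x => congrArg (fun χ : GradedOperad.Hom _ T => χ.map x) key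

/-- Stage `s + 1` is built by operad operations from stage `s` and the cells of index `s`. The
strict bound `t < s` is what makes the cells a filtration with decreasing differential, since cells
of index `s` are attached along cycles of stage `s`. -/
theorem generated_ofStage (s : ℕ) {n : ℕ} {c : Fin (n + 1) → C} {d : C} {p : ℤ}
    (x : (stage f s).obj n c d p) :
    (model f).Generated
      (fun n c d p => Set.range (fun x : S.obj n c d p => (modelIncl f).map x) ∪
        {y | ∃ t < s, ∃ e : (stageCells f t).obj n c d p, y = (modelCell f t).map e})
      ((ofStage _ (stageIncl f) s).map x) := by
  induction s generalizing n c d p with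
  | zero => exact .of _ (.inl ⟨x, rfl⟩)
  | succ s ih =>
    set ι := ofStage _ (stageIncl f) (s + 1)
    induction x using adjoin_induction with
    | base x =>
      refine Eq.mp (congrArg _ (ofStage_succ (i := stageIncl f) s x).symm) <|
        (ih x).mono fun n c d p => Set.union_subset_union_right _ ?_
      rintro y ⟨t, ht, e, rfl⟩
      exact ⟨t, ht.trans (Nat.lt_succ_self s), e, rfl⟩
    | cell e => exact .of _ (.inr ⟨s, Nat.lt_succ_self s, e, rfl⟩)
    | add x y hx hy => exact (map_add ι.map x y).symm ▸ .add _ _ hx hy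
    | smul r x hx => exact (map_smul ι.map r x).symm ▸ .smul r _ hx
    | act σ h x hx => exact (ι.map_act σ h x).symm ▸ .act σ h _ hx
    | comp g hr x y hx hy => exact (ι.map_comp g hr x y).symm ▸ .comp g hr _ _ hx hy

theorem isElementalCofibration_modelIncl : (modelIncl f).IsElementalCofibration := by
  refine ⟨stageCells f, _, freeIncl _, modelFree f, isFree_freeIncl _, isCoproduct_model f, ?_⟩
  intro s n c d p p' h e
  obtain rfl : p' = p - 1 := by omega
  rw [modelFree_cell, diff_modelCell]
  refine (generated_ofStage f s _).mono fun n c d p => Set.union_subset_union_right _ ?_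
  rintro y ⟨t, ht, e, rfl⟩
  exact ⟨t, ht, e, (modelFree_cell f t e).symm⟩

end Model

end DGOperad

theorem mainTheorem6 {k : Type u} [Field k] [CharZero k] {C : Type v} :
    (∀ (S Q : DGOperad.{u, v, w} k C) (f : DGOperad.Hom S Q),
      ∃ (R : DGOperad.{u, v, w} k C) (ι : DGOperad.Hom S R) (α : DGOperad.Hom R Q),
        ι.IsElementalCofibration ∧ α.IsHomologyIso ∧ α.comp ι = f) ∧
    (∀ P : DGOperad.{u, v, w} k C,
      ∃ (R : DGOperad.{u, v, w} k C) (α : DGOperad.Hom R P),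
        R.IsElementallyCofibrant ∧ α.IsHomologyIso) := by
  refine ⟨fun S Q f => ⟨DGOperad.model f, DGOperad.modelIncl f, DGOperad.modelProj f,
    DGOperad.isElementalCofibration_modelIncl f, DGOperad.isHomologyIso_modelProj f,
    DGOperad.modelProj_comp_modelIncl f⟩, fun P => ⟨DGOperad.model P.unitMap,
    DGOperad.modelProj P.unitMap, ?_, DGOperad.isHomologyIso_modelProj P.unitMap⟩⟩
  -- The second claim is the first applied to `𝟏 → P`; initiality of `𝟏` identifies the resulting
  -- inclusion with the canonical unit map.
  have h : (DGOperad.model P.unitMap).unitMap = DGOperad.modelIncl P.unitMap :=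
    DGOperad.Hom.ext_toGradedHom (GradedOperad.trivialOperad_hom_ext _ _)
  rw [DGOperad.IsElementallyCofibrant, h]
  exact DGOperad.isElementalCofibration_modelIncl P.unitMap
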